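/- Let $\mathcal C$ and $\mathcal D$ be rigidly-compactly generated tensor-triangulated categories: triangulated categories with a compatible closed symmetric monoidal structure (unit $\mathbb 1$, internal hom $\underline{\hom}$), with arbitrary coproducts, generated by a set of compact objects, and whose compact objects are exactly the rigid ones. Write $\mathcal C^c,\mathcal D^c$ for the compact objects. Let $f^*:\mathcal D\to\mathcal C$ be a strong symmetric monoidal exact functor which preserves arbitrary coproducts. Then $f^*$ has a right adjoint $f_*:\mathcal C\to\mathcal D$, and $f_*$ has a right adjoint $f^{(1)}:\mathcal D\to\mathcal C$; put $\omega:=f^{(1)}(\mathbb 1)$. Suppose that $f^*$ satisfies Grothendieck–Neeman duality, i.e. that $f_*$ preserves compact objects. A $\mathcal D^c$-submodule is a thick triangulated subcategory $\mathcal D_0\subset\mathcal D$ with $c\otimes x\in\mathcal D_0$ for all $c\in\mathcal D^c$, $x\in\mathcal D_0$ (and similarly for $\mathcal C$). An object $\kappa\in\mathcal D_0$ is dualizing for $\mathcal D_0$ if $\Delta_\kappa:=\underline{\hom}(-,\kappa)$ restricts to an anti-equivalence $\mathcal D_0^{\mathrm{op}}\xrightarrow{\sim}\mathcal D_0$. Let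 $\mathcal D_0\subset\mathcal D$ be a $\mathcal D^c$-submodule with dualizing object $\kappa\in\mathcal D_0$, and let $$f^\#(\mathcal D_0):=\{x\in\mathcal C\mid f_*(c\otimes x)\in\mathcal D_0\text{ for all }c\in\mathcal C^c\}.$$ Then: 1. $\kappa':=f^{(1)}(\kappa)\cong\omega\otimes f^*(\kappa)$. 2. $f^\#(\mathcal D_0)$ is a $\mathcal C^c$-submodule of $\mathcal C$, and $\kappa'$ is a dualizing object for it. 3. $f_*$ restricts to an exact functor $f^\#(\mathcal D_0)\to\mathcal D_0$, and this functor is duality-preserving for $\Delta_{\kappa'}$ and $\Delta_\kappa$: the canonical maps $\zeta_x:f_*\Delta_{\kappa'}(x)\to\Delta_\kappa f_*(x)$ (induced by the lax monoidal structure of $f_*$ and the counit $f_*f^{(1)}\to\mathrm{Id}$) form a natural isomorphism, and for all $x\in f^\#(\mathcal D_0)$ one has $\zeta_{\Delta_{\kappa'}(x)}\circ f_*(\varpi_x)=\Delta_\kappa(\zeta_x)\circ\varpi_{f_*(x)}$, where $\varpi:y\to\Delta\Delta(y)$ denotes the canonical maps to the double duals. -/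

import Mathlib

open CategoryTheory CategoryTheory.Limits CategoryTheory.MonoidalCategory
open CategoryTheory.Pretriangulated

universe v u₁ u₂

noncomputable section

namespace TTDuality

/-! ### Tensor-triangulated categories -/

section TensorTriangulated

variable (C : Type u₁) [Category.{v} C] [Preadditive C] [HasZeroObject C] [HasShift C ℤ]
  [∀ n : ℤ, (shiftFunctor C n).Additive] [Pretriangulated C]
  [MonoidalCategory C] [SymmetricCategory C] [MonoidalClosed C]

variable {C} in
/-- The canonical morphism `Σ hom(ΣX, W) ⟶ hom(X, W)`, adjoint to
`X ⊗ Σ hom(ΣX, W) ≅ Σ (X ⊗ hom(ΣX, W)) ≅ ΣX ⊗ hom(ΣX, W) ⟶ W`. -/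
def shiftIhomShift [(curriedTensor C).CommShift₂Int] (X W : C) :
    ((ihom (X⟦(1 : ℤ)⟧)).obj W)⟦(1 : ℤ)⟧ ⟶ (ihom X).obj W :=
  MonoidalClosed.curry
    ((((curriedTensor C).obj X).commShiftIso (1 : ℤ)).hom.app ((ihom (X⟦(1 : ℤ)⟧)).obj W) ≫
      (((curriedTensor C).flip.obj ((ihom (X⟦(1 : ℤ)⟧)).obj W)).commShiftIso (1 : ℤ)).inv.app X ≫
        (ihom.ev (X⟦(1 : ℤ)⟧)).app W)

/-- A closed symmetric monoidal structure compatible with the triangulation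
(in the sense of Hovey, Palmieri and Strickland).

The structure `CommShift₂Int` consists of natural isomorphisms `ΣⁿX ⊗ Y ≅ Σⁿ(X ⊗ Y)` and
`X ⊗ ΣⁿY ≅ Σⁿ(X ⊗ Y)`, where interchanging `Σᵐ` and `Σⁿ` produces the sign `(-1) ^ (m * n)`.
They are compatible with the unit, the associator and the symmetry; the tensor product is exact
and the internal hom is exact in the first variable. (Exactness of the tensor product in the other
variable follows by symmetry, and that of the internal hom in the second variable holds because it
is right adjoint to an exact functor.) -/
class TensorTriangulatedCategory where
  commShift₂ : (curriedTensor C).CommShift₂Int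
  rightUnitor_shift (X : C) (n : ℤ) :
    (((curriedTensor C).flip.obj (𝟙_ C)).commShiftIso n).hom.app X ≫ (ρ_ X).hom⟦n⟧' =
      (ρ_ (X⟦n⟧)).hom
  associator_shift (X Y Z : C) (n : ℤ) :
    (α_ (X⟦n⟧) Y Z).hom ≫ (((curriedTensor C).flip.obj (Y ⊗ Z)).commShiftIso n).hom.app X =
      (((curriedTensor C).flip.obj Y).commShiftIso n).hom.app X ▷ Z ≫
        (((curriedTensor C).flip.obj Z).commShiftIso n).hom.app (X ⊗ Y) ≫ (α_ X Y Z).hom⟦n⟧'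
  braiding_shift (X Y : C) (n : ℤ) :
    (β_ X (Y⟦n⟧)).hom ≫ (((curriedTensor C).flip.obj X).commShiftIso n).hom.app Y =
      (((curriedTensor C).obj X).commShiftIso n).hom.app Y ≫ (β_ X Y).hom⟦n⟧'
  tensor_exact (Y : C) : ((curriedTensor C).flip.obj Y).IsTriangulated
  ihom_exact (T : Triangle C) (_ : T ∈ distTriang C) (W : C) :
    ∃ δ : (ihom T.obj₁).obj W ⟶ ((ihom T.obj₃).obj W)⟦(1 : ℤ)⟧,
      shiftIhomShift T.obj₁ W ≫ δ = ((MonoidalClosed.pre T.mor₃).app W)⟦(1 : ℤ)⟧' ∧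
      Triangle.mk ((MonoidalClosed.pre T.mor₂).app W) ((MonoidalClosed.pre T.mor₁).app W) δ ∈
        distTriang C

end TensorTriangulated

/-! ### Compact and rigid objects, rigidly-compactly generated categories -/

section Compact

variable {C : Type u₁} [Category.{v} C] {D : Type u₂} [Category.{v} D]

/-- Preservation of arbitrary (small) coproducts. -/
def PreservesSmallCoproducts (F : C ⥤ D) : Prop :=
  ∀ J : Type v, PreservesColimitsOfShape (Discrete J) F

/-- An object `x` is compact if `Hom(x, -)`, with values in abelian groups,
preserves coproducts. -/
def IsCompactObject [Preadditive C] (x : C) : Prop :=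
  ∀ J : Type v, PreservesColimitsOfShape (Discrete J) (preadditiveCoyoneda.obj (Opposite.op x))

/-- The functor `F` preserves compact objects. -/
def PreservesCompactObjects [Preadditive C] [Preadditive D] (F : C ⥤ D) : Prop :=
  ∀ c : C, IsCompactObject c → IsCompactObject (F.obj c)

/-- The natural map `hom(x, 𝟙) ⊗ y ⟶ hom(x, y)`. -/
def rigidComparison [MonoidalCategory C] [MonoidalClosed C] (x y : C) :
    (ihom x).obj (𝟙_ C) ⊗ y ⟶ (ihom x).obj y :=
  MonoidalClosed.curry
    ((α_ x ((ihom x).obj (𝟙_ C)) y).inv ≫ (ihom.ev x).app (𝟙_ C) ▷ y ≫ (λ_ y).hom)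

/-- An object `x` is rigid if `hom(x, 𝟙) ⊗ y ⟶ hom(x, y)` is an isomorphism for all `y`. -/
def IsRigidObject [MonoidalCategory C] [MonoidalClosed C] (x : C) : Prop :=
  ∀ y : C, IsIso (rigidComparison x y)

variable (C) in
/-- `C` has all small coproducts and a (small) set of compact objects `G i` such that `t = 0`
whenever `Hom(G i, t) = 0` for all `i`; moreover the compact objects are the rigid ones. -/
structure IsRigidlyCompactlyGenerated [Preadditive C] [MonoidalCategory C]
    [MonoidalClosed C] : Prop where
  hasCoproducts : HasCoproducts.{v} C
  exists_generators : ∃ (ι : Type v) (G : ι → C), (∀ i, IsCompactObject (G i)) ∧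
    ∀ t : C, (∀ (i : ι) (φ : G i ⟶ t), φ = 0) → IsZero t
  compact_iff_rigid : ∀ x : C, IsCompactObject x ↔ IsRigidObject x

/-- A `Cᶜ`-submodule of `C`: a thick triangulated subcategory which is closed under tensoring
with compact objects of `C`. -/
class IsCompactSubmodule [Preadditive C] [HasZeroObject C] [HasShift C ℤ]
    [∀ n : ℤ, (shiftFunctor C n).Additive] [Pretriangulated C] [MonoidalCategory C]
    (P : ObjectProperty C) : Prop where
  isTriangulated : P.IsTriangulated
  isStableUnderRetracts : P.IsStableUnderRetracts
  tensor_mem : ∀ c x : C, IsCompactObject c → P x → P (c ⊗ x)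

attribute [instance] IsCompactSubmodule.isTriangulated

/-- The compact pull-back `{x | g (c ⊗ x) ∈ D₀ for all compact c}` along `g : C ⥤ D`. -/
def compactPullback [Preadditive C] [MonoidalCategory C] (g : C ⥤ D) (D₀ : ObjectProperty D) :
    ObjectProperty C :=
  fun x => ∀ c : C, IsCompactObject c → D₀ (g.obj (c ⊗ x))

end Compact

/-! ### Categories with (weak) duality -/

section Duality

variable {A : Type u₁} [Category.{v} A] {B : Type u₂} [Category.{v} B]

variable (A) in
/-- A weak duality: a contravariant functor `dual` with a natural transformation
`ϖ : x ⟶ dual (dual x)` such that `ϖ (dual x) ≫ dual (ϖ x) = 𝟙`.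
It is a (strong) duality when `dual` is an equivalence. -/
structure WeakDuality where
  dual : Aᵒᵖ ⥤ A
  bidual : 𝟭 A ⟶ dual.rightOp ⋙ dual
  bidual_dual (x : A) :
    bidual.app (dual.obj (Opposite.op x)) ≫ dual.map (bidual.app x).op =
      𝟙 (dual.obj (Opposite.op x))

/-- The restriction of a weak duality to a full subcategory which is stable under `dual`. -/
def WeakDuality.restrict (d : WeakDuality A) (P : ObjectProperty A)
    (h : ∀ x : A, P x → P (d.dual.obj (Opposite.op x))) : WeakDuality P.FullSubcategory where
  dual := P.lift (P.ι.op ⋙ d.dual) (fun x => h _ x.unop.property)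
  bidual :=
    { app := fun x => ObjectProperty.homMk (d.bidual.app x.obj)
      naturality := fun _ _ f => ObjectProperty.hom_ext _ (d.bidual.naturality f.hom) }
  bidual_dual := fun x => ObjectProperty.hom_ext _ (d.bidual_dual x.obj)

/-- The data making `F` a duality-preserving functor: a natural isomorphism
`ζ : F (dual x) ≅ dual (F x)` compatible with the maps to the double duals. -/
structure DualityPreserving (dA : WeakDuality A) (dB : WeakDuality B) (F : A ⥤ B) where
  ζ : dA.dual ⋙ F ≅ F.op ⋙ dB.dual
  comm (x : A) :
    F.map (dA.bidual.app x) ≫ ζ.hom.app (Opposite.op (dA.dual.obj (Opposite.op x))) =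
      dB.bidual.app (F.obj x) ≫ dB.dual.map (ζ.hom.app (Opposite.op x)).op

end Duality

/-! ### Twisted dualities and dualizing objects -/

section Twisted

variable {C : Type u₁} [Category.{v} C] [MonoidalCategory C] [SymmetricCategory C]
  [MonoidalClosed C]

/-- The canonical morphism `x ⟶ hom(hom(x, κ), κ)`. -/
def toBidual (κ x : C) : x ⟶ (ihom ((ihom x).obj κ)).obj κ :=
  MonoidalClosed.curry ((β_ ((ihom x).obj κ) x).hom ≫ (ihom.ev x).app κ)

theorem toBidual_naturality (κ : C) {x y : C} (f : x ⟶ y) :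
    f ≫ toBidual κ y =
      toBidual κ x ≫ (MonoidalClosed.pre ((MonoidalClosed.pre f).app κ)).app κ := by
  apply MonoidalClosed.uncurry_injective
  rw [MonoidalClosed.uncurry_pre_app, MonoidalClosed.uncurry_natural_left, toBidual, toBidual,
    MonoidalClosed.uncurry_curry, MonoidalClosed.uncurry_curry,
    BraidedCategory.braiding_naturality_right_assoc, BraidedCategory.braiding_naturality_left_assoc,
    MonoidalClosed.id_tensor_pre_app_comp_ev]

theorem toBidual_pre (κ x : C) :
    toBidual κ ((ihom x).obj κ) ≫ (MonoidalClosed.pre (toBidual κ x)).app κ = 𝟙 _ := by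
  apply MonoidalClosed.uncurry_injective
  rw [MonoidalClosed.uncurry_pre_app, toBidual, toBidual, MonoidalClosed.uncurry_curry,
    BraidedCategory.braiding_naturality_left_assoc,
    MonoidalClosed.whiskerLeft_curry_ihom_ev_app, SymmetricCategory.symmetry_assoc,
    MonoidalClosed.uncurry_id_eq_ev]

/-- The `κ`-twisted duality `hom(-, κ)`. -/
def twistedDuality (κ : C) : WeakDuality C where
  dual := MonoidalClosed.internalHom.flip.obj κ
  bidual :=
    { app := fun x => toBidual κ x
      naturality := fun _ _ f => toBidual_naturality κ f }
  bidual_dual := fun x => toBidual_pre κ x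

/-- The object `κ` of `P` is dualizing for `P` if `hom(-, κ)` restricts to an anti-equivalence
of the full subcategory `P`. -/
structure IsDualizing (P : ObjectProperty C) (κ : C) : Prop where
  mem : P κ
  stable : ∀ x : C, P x → P ((twistedDuality κ).dual.obj (Opposite.op x))
  isEquivalence : ((twistedDuality κ).restrict P stable).dual.IsEquivalence

variable {D : Type u₂} [Category.{v} D] [MonoidalCategory D] [SymmetricCategory D]
  [MonoidalClosed D]

/-- For `f ⊣ g ⊣ h` with `f` strong monoidal, the canonical morphism
`g hom(x, h κ) ⟶ hom(g x, g h κ) ⟶ hom(g x, κ)`, given by the lax monoidal structure of `g`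
and the counit of `g ⊣ h`. -/
def dualComparison {f : D ⥤ C} [f.Monoidal] {g : C ⥤ D} {h : D ⥤ C} (adj₁ : f ⊣ g) (adj₂ : g ⊣ h)
    (κ : D) (x : C) :
    g.obj ((ihom x).obj (h.obj κ)) ⟶ (ihom (g.obj x)).obj κ :=
  letI : g.LaxMonoidal := adj₁.rightAdjointLaxMonoidal
  MonoidalClosed.curry
    (Functor.LaxMonoidal.μ g x ((ihom x).obj (h.obj κ)) ≫
      g.map ((ihom.ev x).app (h.obj κ)) ≫ adj₂.counit.app κ)

end Twisted

end TTDuality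

end

set_option linter.unusedSectionVars false

namespace TTDuality

/-! ### Maps from compact objects -/

/-! Write `f ⊣ g ⊣ h`. Everything follows from the projection formula `g x ⊗ y ≅ g (x ⊗ f y)` and
Yoneda.

Existence of adjoints is Brown representability (`isLeftAdjoint_of_preservesSmallCoproducts`). A
strong monoidal `f` preserves dualizable objects, hence compact ones, so `g` preserves coproducts
and is itself a left adjoint. Grothendieck–Neeman duality is the same condition one step up, so `h`
preserves coproducts.

The projection map and the map `h 𝟙 ⊗ f y ⟶ h y` are invertible for dualizable `y` by moving `y` to
the other side of Hom. In `y` they compare exact functors preserving coproducts, so the case of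
compact `y` implies the general one (`isIso_app_of_compact`).

The projection formula makes `ζ` invertible: `Hom(t, g hom(x, h κ)) = Hom(x ⊗ f t, h κ) = Hom(g (x ⊗
f t), κ) = Hom(g x ⊗ t, κ) = Hom(t, hom(g x, κ))`. If `d` is dual to a compact `c`, then `c ⊗ hom(x,
h κ) ≅ hom(x ⊗ d, h κ)`, which `g` sends to `hom(g (x ⊗ d), κ)`; so the pull-back is stable under
the duality. For reflexivity, compatibility of `ζ` with the maps `ϖ` shows that `g ϖ` is invertible.
This need not suffice for `ϖ` itself, but it applies to `x ⊗ c` for every compact `c`: it gives a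
bijection on maps from the unit into `x ⊗ c`, hence on maps from the dual of `c` into `x`, and the
compact objects detect isomorphisms. -/

theorem isIso_of_yoneda_bijective {C : Type u₁} [Category.{v} C] {X Y : C} (f : X ⟶ Y)
    (h : ∀ t : C, Function.Bijective (fun u : t ⟶ X => u ≫ f)) : IsIso f := by
  obtain ⟨g, hg⟩ := (h Y).2 (𝟙 Y)
  refine ⟨g, (h X).1 ?_, hg⟩
  dsimp at hg ⊢
  rw [Category.assoc, hg, Category.comp_id, Category.id_comp]

section CompactObjects

variable {C : Type u₁} [Category.{v} C] [Preadditive C]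

/-- Every map from a compact object to a coproduct is a sum of maps through the summands. -/
theorem IsCompactObject.hom_induction {x : C} (hx : IsCompactObject x) {J : Type v} {X : J → C}
    [HasCoproduct X] {motive : (x ⟶ ∐ X) → Prop}
    (ι : ∀ (j : J) (ψ : x ⟶ X j), motive (ψ ≫ Sigma.ι X j))
    (zero : motive 0) (add : ∀ φ ψ, motive φ → motive ψ → motive (φ + ψ)) (φ : x ⟶ ∐ X) :
    motive φ := by
  -- The motive is not assumed stable under negation, so the subgroup asks for it at `φ` and at
  -- `-φ`.
  let S : AddSubgroup (x ⟶ ∐ X) :=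
    { carrier := {φ | motive φ ∧ motive (-φ)}
      zero_mem' := ⟨zero, by simpa using zero⟩
      add_mem' := fun {a b} ha hb =>
        ⟨add _ _ ha.1 hb.1, by rw [neg_add]; exact add _ _ ha.2 hb.2⟩
      neg_mem' := fun {a} ha => ⟨ha.2, by simpa using ha.1⟩ }
  have := hx J
  let F := preadditiveCoyoneda.obj (Opposite.op x)
  have hc : IsColimit (F.mapCocone (Cofan.mk (∐ X) (Sigma.ι X))) :=
    isColimitOfPreserves F (coproductIsCoproduct X)
  let q : F.obj (∐ X) ⟶ AddCommGrpCat.of ((x ⟶ ∐ X) ⧸ S) :=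
    AddCommGrpCat.ofHom (QuotientAddGroup.mk' S)
  -- A map out of a coproduct of abelian groups is tested on the summands, and there it lands in
  -- `S`.
  have hq : q = 0 := by
    refine hc.hom_ext fun j => ?_
    ext ψ
    change QuotientAddGroup.mk' S (ψ ≫ Sigma.ι X j.as) = 0
    refine (QuotientAddGroup.eq_zero_iff _).2 ⟨ι _ _, ?_⟩
    exact (congrArg motive (Preadditive.neg_comp (show x ⟶ X j.as from ψ) _)).mp (ι _ _)
  have h := congr($hq φ)
  exact ((QuotientAddGroup.eq_zero_iff φ).1 h).1

open scoped Classical in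
/-- The projections of a coproduct to its summands. -/
noncomputable def sigmaProj {J : Type v} (X : J → C) [HasCoproduct X] (j : J) : ∐ X ⟶ X j :=
  Sigma.desc fun i => if h : i = j then eqToHom (by rw [h]) else 0

@[simp]
theorem ι_sigmaProj_self {J : Type v} (X : J → C) [HasCoproduct X] (j : J) :
    Sigma.ι X j ≫ sigmaProj X j = 𝟙 _ := by
  simp [sigmaProj]

theorem ι_sigmaProj_of_ne {J : Type v} (X : J → C) [HasCoproduct X] {i j : J} (h : i ≠ j) :
    Sigma.ι X i ≫ sigmaProj X j = 0 := by
  simp [sigmaProj, h]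

/-- A map from a compact object to a coproduct is determined by its components. -/
theorem IsCompactObject.eq_zero_of_sigmaProj {x : C} (hx : IsCompactObject x) {J : Type v}
    {X : J → C} [HasCoproduct X] (φ : x ⟶ ∐ X) (h : ∀ j, φ ≫ sigmaProj X j = 0) : φ = 0 := by
  classical
  -- Allowing every larger `t` lets the finite supports of two summands be merged.
  have key : ∃ s : Finset J, ∀ t : Finset J, s ⊆ t →
      φ = ∑ j ∈ t, (φ ≫ sigmaProj X j) ≫ Sigma.ι X j := by
    refine hx.hom_induction
      (motive := fun φ => ∃ s : Finset J, ∀ t : Finset J, s ⊆ t →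
        φ = ∑ j ∈ t, (φ ≫ sigmaProj X j) ≫ Sigma.ι X j) ?_ ?_ ?_ φ
    · intro i ψ
      refine ⟨{i}, fun t ht => ?_⟩
      rw [Finset.sum_eq_single i]
      · simp
      · intro j _ hj
        simp [ι_sigmaProj_of_ne X hj.symm]
      · intro hi
        exact absurd (ht (Finset.mem_singleton_self i)) hi
    · exact ⟨∅, fun t _ => by simp⟩
    · rintro φ ψ ⟨s, hs⟩ ⟨s', hs'⟩
      refine ⟨s ∪ s', fun t ht => ?_⟩
      have h₁ := hs t (Finset.union_subset_left ht)
      have h₂ := hs' t (Finset.union_subset_right ht)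
      simp only [Preadditive.add_comp, Finset.sum_add_distrib]
      rw [← h₁, ← h₂]
  obtain ⟨s, hs⟩ := key
  rw [hs s (Finset.Subset.refl s)]
  simp [h]

/-- A left adjoint preserves compact objects if its right adjoint preserves coproducts. -/
theorem IsCompactObject.map_leftAdjoint {D : Type u₂} [Category.{v} D] [Preadditive D]
    {L : C ⥤ D} {R : D ⥤ C} (adj : L ⊣ R) [L.Additive] (hR : PreservesSmallCoproducts R)
    {x : C} (hx : IsCompactObject x) : IsCompactObject (L.obj x) := fun J => by
  have := hx J
  have := hR J
  exact preservesColimitsOfShape_of_natIso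
    (F := R ⋙ preadditiveCoyoneda.obj (Opposite.op x)) (NatIso.ofComponents
      (fun y => AddEquiv.toAddCommGrpIso (adj.homAddEquiv x y).symm) (fun {y z} f => by
        ext φ
        exact adj.homEquiv_naturality_right_symm (X := x) φ f))

end CompactObjects

/-! ### Functors preserving coproducts. -/

section Coproducts

variable {C : Type u₁} [Category.{v} C] {D : Type u₂} [Category.{v} D]

theorem PreservesSmallCoproducts.of_isLeftAdjoint (F : C ⥤ D)
    [F.IsLeftAdjoint] : PreservesSmallCoproducts F := fun _ =>
  ⟨fun {_} => inferInstance⟩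

theorem PreservesSmallCoproducts.comp {E : Type*} [Category.{v} E]
    {F : C ⥤ D} {G : D ⥤ E} (hF : PreservesSmallCoproducts F) (hG : PreservesSmallCoproducts G) :
    PreservesSmallCoproducts (F ⋙ G) := fun J => by
  have := hF J
  have := hG J
  infer_instance

theorem PreservesSmallCoproducts.exists_desc {F : D ⥤ C} (hF : PreservesSmallCoproducts F)
    {J : Type v} (X : J → D) [HasCoproduct X] {c : C} (y : ∀ j, F.obj (X j) ⟶ c) :
    ∃ z : F.obj (∐ X) ⟶ c, ∀ j, F.map (Sigma.ι X j) ≫ z = y j := by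
  have := hF J
  have hc : IsColimit (F.mapCocone (Cofan.mk (∐ X) (Sigma.ι X))) :=
    isColimitOfPreserves F (coproductIsCoproduct X)
  exact ⟨hc.desc ⟨c, Discrete.natTrans fun j => y j.as⟩, fun j => hc.fac _ ⟨j⟩⟩

theorem PreservesSmallCoproducts.hom_ext {F : D ⥤ C} (hF : PreservesSmallCoproducts F)
    {J : Type v} (X : J → D) [HasCoproduct X] {c : C} {y z : F.obj (∐ X) ⟶ c}
    (h : ∀ j, F.map (Sigma.ι X j) ≫ y = F.map (Sigma.ι X j) ≫ z) : y = z := by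
  have := hF J
  have hc : IsColimit (F.mapCocone (Cofan.mk (∐ X) (Sigma.ι X))) :=
    isColimitOfPreserves F (coproductIsCoproduct X)
  exact hc.hom_ext fun j => h j.as

theorem isIso_app_sigma {F G : D ⥤ C} (hF : PreservesSmallCoproducts F)
    (hG : PreservesSmallCoproducts G) (θ : F ⟶ G) {J : Type v} (X : J → D) [HasCoproduct X]
    (h : ∀ j, IsIso (θ.app (X j))) : IsIso (θ.app (∐ X)) := by
  obtain ⟨z, hz⟩ := hG.exists_desc X (fun j => inv (θ.app (X j)) ≫ F.map (Sigma.ι X j))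
  refine ⟨z, hF.hom_ext X fun j => ?_, hG.hom_ext X fun j => ?_⟩
  · rw [NatTrans.naturality_assoc, hz, IsIso.hom_inv_id_assoc, Category.comp_id]
  · rw [← Category.assoc, hz, Category.assoc, NatTrans.naturality, IsIso.inv_hom_id_assoc,
      Category.comp_id]

end Coproducts

end TTDuality

namespace TTDuality

/-! ### Brown representability -/

section Brown

open ZeroObject

variable {D : Type u₁} [Category.{v} D] [Preadditive D] [HasZeroObject D] [HasShift D ℤ]
  [∀ n : ℤ, (shiftFunctor D n).Additive] [Pretriangulated D]

theorem distTriang_mk_comp₁₂ {X Y Z : D} {a : X ⟶ Y} {b : Y ⟶ Z} {c : Z ⟶ X⟦(1 : ℤ)⟧}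
    (hT : Triangle.mk a b c ∈ distTriang D) : a ≫ b = 0 :=
  comp_distTriang_mor_zero₁₂ _ hT

theorem distTriang_mk_comp₃₁ {X Y Z : D} {a : X ⟶ Y} {b : Y ⟶ Z} {c : Z ⟶ X⟦(1 : ℤ)⟧}
    (hT : Triangle.mk a b c ∈ distTriang D) : c ≫ a⟦(1 : ℤ)⟧' = 0 :=
  comp_distTriang_mor_zero₃₁ _ hT

theorem distTriang_mk_coyoneda_exact₃ {X Y Z : D} {a : X ⟶ Y} {b : Y ⟶ Z} {c : Z ⟶ X⟦(1 : ℤ)⟧}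
    (hT : Triangle.mk a b c ∈ distTriang D) {t : D} (φ : t ⟶ Z) (h : φ ≫ c = 0) :
    ∃ ψ : t ⟶ Y, φ = ψ ≫ b :=
  Triangle.coyoneda_exact₃ _ hT φ h

theorem IsCompactObject.shift {x : D} (hx : IsCompactObject x) (n : ℤ) :
    IsCompactObject (x⟦n⟧) :=
  have : (shiftEquiv D n).functor.Additive := inferInstanceAs (shiftFunctor D n).Additive
  hx.map_leftAdjoint (shiftEquiv D n).toAdjunction
    (PreservesSmallCoproducts.of_isLeftAdjoint (shiftEquiv D n).inverse)

/-- A (small) family of compact objects, stable under desuspension, which detects zero objects. -/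
structure IsCompactGeneratingFamily {ι : Type v} (G : ι → D) : Prop where
  compact : ∀ i, IsCompactObject (G i)
  desuspension : ∀ i, ∃ j, Nonempty (G j ≅ (G i)⟦(-1 : ℤ)⟧)
  isZero : ∀ t : D, (∀ (i : ι) (φ : G i ⟶ t), φ = 0) → IsZero t

/-- The cone receives no nonzero map from a generator: after desuspension, injectivity kills its
composite with the connecting map, so it lifts to `Y`, and surjectivity lifts it further to `X`. -/
theorem IsCompactGeneratingFamily.isIso {ι : Type v} {G : ι → D}
    (hG : IsCompactGeneratingFamily G) {X Y : D} (a : X ⟶ Y)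
    (inj : ∀ (i : ι) (φ : G i ⟶ X), φ ≫ a = 0 → φ = 0)
    (surj : ∀ (i : ι) (ψ : G i ⟶ Y), ∃ φ : G i ⟶ X, φ ≫ a = ψ) : IsIso a := by
  obtain ⟨Z, b, c, hT⟩ := distinguished_cocone_triangle a
  have hZ : IsZero Z := hG.isZero Z fun i φ => by
    have h₁ : φ ≫ c = 0 := by
      obtain ⟨j, ⟨e⟩⟩ := hG.desuspension i
      let e' : (G j)⟦(1 : ℤ)⟧ ≅ G i :=
        (shiftFunctor D (1 : ℤ)).mapIso e ≪≫ (shiftFunctorCompIsoId D (-1 : ℤ) 1 (by simp)).app _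
      obtain ⟨ψ, hψ⟩ := (shiftFunctor D (1 : ℤ)).map_surjective (e'.hom ≫ φ ≫ c)
      have h₂ : ψ ≫ a = 0 := by
        apply (shiftFunctor D (1 : ℤ)).map_injective
        rw [Functor.map_comp, hψ, Functor.map_zero, Category.assoc, Category.assoc,
          distTriang_mk_comp₃₁ hT, comp_zero, comp_zero]
      rw [inj j ψ h₂, Functor.map_zero] at hψ
      rw [← cancel_epi e'.hom, ← hψ, comp_zero]
    obtain ⟨ψ, rfl⟩ := distTriang_mk_coyoneda_exact₃ hT φ h₁
    obtain ⟨φ', rfl⟩ := surj i ψ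
    rw [Category.assoc, distTriang_mk_comp₁₂ hT, comp_zero]
  exact (Triangle.isZero₃_iff_isIso₁ _ hT).1 hZ

/-- A class of objects which is closed under small coproducts and cones. -/
structure IsLocalizingClass (P : ObjectProperty D) : Prop where
  sigma : ∀ {J : Type v} (X : J → D) [HasCoproduct X], (∀ j, P (X j)) → P (∐ X)
  cone : ∀ T ∈ distTriang D, P T.obj₁ → P T.obj₂ → P T.obj₃

variable {C : Type u₂} [Category.{v} C] [Preadditive C] [HasZeroObject C] [HasShift C ℤ]
  [∀ n : ℤ, (shiftFunctor C n).Additive] [Pretriangulated C]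

/-- A map `F (cone) ⟶ c` extending a given map. -/
theorem exists_extension_of_distTriang (F : D ⥤ C) [F.CommShift ℤ] [F.IsTriangulated]
    {X Y Z : D} {a : X ⟶ Y} {b : Y ⟶ Z} {d : Z ⟶ X⟦(1 : ℤ)⟧}
    (hT : Triangle.mk a b d ∈ distTriang D) {c : C} (x : F.obj Y ⟶ c)
    (hx : F.map a ≫ x = 0) : ∃ x' : F.obj Z ⟶ c, F.map b ≫ x' = x := by
  obtain ⟨x', h⟩ := Triangle.yoneda_exact₂ _ (F.map_distinguished _ hT) x hx
  exact ⟨x', h.symm⟩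

variable [HasCoproducts.{v} D]

/-- The coproduct of an object with a family of objects. -/
theorem exists_wedge (Y : D) {J : Type v} (K : J → D) :
    ∃ (W : D) (l : Y ⟶ W) (r : ∀ j, K j ⟶ W),
      (∀ P : ObjectProperty D, IsLocalizingClass P → P Y → (∀ j, P (K j)) → P W) ∧
      (∀ (F : D ⥤ C), PreservesSmallCoproducts F → ∀ (c : C) (y : F.obj Y ⟶ c)
        (k : ∀ j, F.obj (K j) ⟶ c),
          ∃ w : F.obj W ⟶ c, F.map l ≫ w = y ∧ ∀ j, F.map (r j) ≫ w = k j) := by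
  let K' : Option J → D := fun j => j.elim Y K
  refine ⟨∐ K', Sigma.ι K' none, fun j => Sigma.ι K' (some j), ?_, ?_⟩
  · intro P hP hY hK
    refine hP.sigma K' fun j => ?_
    cases j with
    | none => exact hY
    | some j => exact hK j
  · intro F hF c y k
    obtain ⟨w, hw⟩ := hF.exists_desc K' (c := c) (fun j => match j with
      | none => y
      | some j => k j)
    exact ⟨w, hw none, fun j => hw (some j)⟩

/-- The homotopy colimit of a sequence. -/
theorem exists_hocolim (X : ℕ → D) (a : ∀ n, X n ⟶ X (n + 1)) :
    ∃ (H : D) (i : ∀ n, X n ⟶ H),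
      (∀ n, a n ≫ i (n + 1) = i n) ∧
      (∀ P : ObjectProperty D, IsLocalizingClass P → (∀ n, P (X n)) → P H) ∧
      (∀ x : D, IsCompactObject x → ∀ φ : x ⟶ H, ∃ n, ∃ ψ : x ⟶ X n, ψ ≫ i n = φ) ∧
      (∀ (F : D ⥤ C) [F.CommShift ℤ] [F.IsTriangulated], PreservesSmallCoproducts F →
        ∀ (c : C) (x : ∀ n, F.obj (X n) ⟶ c), (∀ n, F.map (a n) ≫ x (n + 1) = x n) →
          ∃ y : F.obj H ⟶ c, ∀ n, F.map (i n) ≫ y = x n) := by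
  -- The hocolim is the cone of `1 - s` on the coproduct, with `s` the shift along the sequence.
  let Y : ULift.{v} ℕ → D := fun n => X n.down
  let s : ∐ Y ⟶ ∐ Y := Sigma.desc fun n => a n.down ≫ Sigma.ι Y ⟨n.down + 1⟩
  have hs (n : ℕ) : Sigma.ι Y ⟨n⟩ ≫ s = a n ≫ Sigma.ι Y ⟨n + 1⟩ := by simp [s]
  obtain ⟨H, p, d, hT⟩ := distinguished_cocone_triangle (𝟙 (∐ Y) - s)
  have hp : s ≫ p = p := by
    have := distTriang_mk_comp₁₂ hT
    rw [Preadditive.sub_comp, Category.id_comp, sub_eq_zero] at this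
    exact this.symm
  have hi (n : ℕ) : a n ≫ Sigma.ι Y ⟨n + 1⟩ ≫ p = Sigma.ι Y ⟨n⟩ ≫ p := by
    rw [← Category.assoc, ← hs, Category.assoc, hp]
  refine ⟨H, fun n => Sigma.ι Y ⟨n⟩ ≫ p, hi, ?_, ?_, ?_⟩
  · intro P hP hX
    exact hP.cone _ hT (hP.sigma Y fun n => hX n.down) (hP.sigma Y fun n => hX n.down)
  · intro x hx φ
    -- The zeroth component of `s` is zero and component `n + 1` factors through component `n`, so
    -- all components of a map fixed by `s` vanish by induction.
    have inj : ∀ z : x⟦(-1 : ℤ)⟧ ⟶ ∐ Y, z ≫ s = z → z = 0 := by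
      intro z hz
      refine (hx.shift (-1)).eq_zero_of_sigmaProj z fun ⟨n⟩ => ?_
      have h₀ : s ≫ sigmaProj Y ⟨0⟩ = 0 := by
        refine Sigma.hom_ext _ _ fun ⟨m⟩ => ?_
        rw [← Category.assoc, hs, Category.assoc, ι_sigmaProj_of_ne, comp_zero, comp_zero]
        simp
      have h₁ (n : ℕ) : s ≫ sigmaProj Y ⟨n + 1⟩ = sigmaProj Y ⟨n⟩ ≫ a n := by
        refine Sigma.hom_ext _ _ fun ⟨m⟩ => ?_
        rw [← Category.assoc, hs, Category.assoc]
        by_cases h : m = n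
        · subst h
          rw [ι_sigmaProj_self, ← Category.assoc, ι_sigmaProj_self]
          simp [Y]
        · rw [ι_sigmaProj_of_ne, ← Category.assoc, ι_sigmaProj_of_ne, comp_zero, zero_comp]
          · simpa using h
          · simpa using h
      induction n with
      | zero => rw [← hz, Category.assoc, h₀, comp_zero]
      | succ n ih => rw [← hz, Category.assoc, h₁, ← Category.assoc, ih, zero_comp]
    have hφ : φ ≫ d = 0 := by
      let e : (x⟦(-1 : ℤ)⟧)⟦(1 : ℤ)⟧ ≅ x := (shiftFunctorCompIsoId D (-1 : ℤ) 1 (by simp)).app x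
      obtain ⟨z, hz⟩ := (shiftFunctor D (1 : ℤ)).map_surjective (e.hom ≫ φ ≫ d)
      have hz' : z ≫ s = z := by
        have : z ≫ (𝟙 _ - s) = 0 := by
          apply (shiftFunctor D (1 : ℤ)).map_injective
          rw [Functor.map_comp, hz, Category.assoc, Category.assoc, distTriang_mk_comp₃₁ hT,
            comp_zero, comp_zero,
            Functor.map_zero]
        rw [Preadditive.comp_sub, Category.comp_id, sub_eq_zero] at this
        exact this.symm
      rw [inj z hz', Functor.map_zero] at hz
      rw [← cancel_epi e.hom, ← hz, comp_zero]
    obtain ⟨w, rfl⟩ := distTriang_mk_coyoneda_exact₃ hT φ hφ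
    change ∃ n, ∃ ψ : x ⟶ X n, ψ ≫ Sigma.ι Y ⟨n⟩ ≫ p = w ≫ p
    clear hφ
    -- Two maps given at different stages are pushed to a common stage before being added.
    have mono (n m : ℕ) (ψ : x ⟶ X n) :
        ∃ ψ' : x ⟶ X (n + m), ψ' ≫ Sigma.ι Y ⟨n + m⟩ ≫ p = ψ ≫ Sigma.ι Y ⟨n⟩ ≫ p := by
      induction m with
      | zero => exact ⟨ψ, rfl⟩
      | succ m ih =>
        obtain ⟨ψ', h⟩ := ih
        exact ⟨ψ' ≫ a (n + m), by rw [← h, ← hi (n + m), Category.assoc]; rfl⟩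
    refine hx.hom_induction (motive := fun w => ∃ n, ∃ ψ : x ⟶ X n, ψ ≫ Sigma.ι Y ⟨n⟩ ≫ p = w ≫ p)
      ?_ ?_ ?_ w
    · rintro ⟨n⟩ ψ
      exact ⟨n, ψ, by rw [Category.assoc]⟩
    · exact ⟨0, 0, by simp⟩
    · rintro w w' ⟨n, ψ, h⟩ ⟨n', ψ', h'⟩
      obtain ⟨ψ₁, h₁⟩ := mono n n' ψ
      obtain ⟨ψ₂, h₂⟩ : ∃ ψ₂ : x ⟶ X (n + n'),
          ψ₂ ≫ Sigma.ι Y ⟨n + n'⟩ ≫ p = ψ' ≫ Sigma.ι Y ⟨n'⟩ ≫ p := by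
        rw [Nat.add_comm]
        exact mono n' n ψ'
      exact ⟨n + n', ψ₁ + ψ₂, by rw [Preadditive.add_comp, Preadditive.add_comp, h₁, h₂, h, h']⟩
  · intro F _ _ hF c x hx
    obtain ⟨y, hy⟩ := hF.exists_desc Y (fun n => x n.down)
    obtain ⟨z, hz⟩ := exists_extension_of_distTriang F hT y (hF.hom_ext Y fun ⟨n⟩ => by
      rw [F.map_sub, F.map_id, Preadditive.sub_comp, Category.id_comp, Preadditive.comp_sub,
        ← Category.assoc, ← F.map_comp, hs, F.map_comp, Category.assoc, hy, hy, comp_zero,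
        sub_eq_zero]
      exact (hx n).symm)
    refine ⟨z, fun n => ?_⟩
    rw [F.map_comp, Category.assoc, hz, hy]

section Representability

variable (F : D ⥤ C) [F.CommShift ℤ] [F.IsTriangulated] (hF : PreservesSmallCoproducts F) (c : C)
  {ι : Type v} (G : ι → D)

include hF in
/-- Killing the kernel of `Hom(G i, X) ⟶ Hom(F (G i), c)`. -/
theorem exists_kill (X : D) (x : F.obj X ⟶ c) :
    ∃ (X' : D) (x' : F.obj X' ⟶ c) (a : X ⟶ X'), F.map a ≫ x' = x ∧
      (∀ i (φ : G i ⟶ X), F.map φ ≫ x = 0 → φ ≫ a = 0) ∧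
      ∀ P : ObjectProperty D, IsLocalizingClass P → (∀ i, P (G i)) → P X → P X' := by
  -- All offending maps are killed at once by the cone of their sum.
  let J : Type v := Σ i, {φ : G i ⟶ X // F.map φ ≫ x = 0}
  let K : J → D := fun j => G j.1
  let k : ∐ K ⟶ X := Sigma.desc fun j => j.2.1
  obtain ⟨X', a, d, hT⟩ := distinguished_cocone_triangle k
  have hk : ∀ j, Sigma.ι K j ≫ k = j.2.1 := fun j => by simp [k]
  obtain ⟨x', hx'⟩ := exists_extension_of_distTriang F hT x (hF.hom_ext K fun j => by
    rw [← Category.assoc, ← F.map_comp, hk, j.2.2, comp_zero])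
  refine ⟨X', x', a, hx', fun i φ hφ => ?_, fun P hP hPG hX =>
    hP.cone _ hT (hP.sigma K fun j => hPG j.1) hX⟩
  have := distTriang_mk_comp₁₂ hT
  exact (congrArg (· ≫ a) (hk ⟨i, φ, hφ⟩)).symm.trans (by rw [Category.assoc, this, comp_zero])

include hF in
-- Surjectivity is built in at the start, by adjoining to `Y` one copy of `G i` for each map `F (G
-- i) ⟶ c`. Killing kernels repeatedly and passing to the homotopy colimit gives injectivity: by
-- compactness a map from `G i` comes from a finite stage, and it dies at the next. The last clause
-- records that only coproducts and cones were used.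
theorem exists_over_bijective (hG : ∀ i, IsCompactObject (G i)) (Y : D) (y : F.obj Y ⟶ c) :
    ∃ (X : D) (x : F.obj X ⟶ c) (a : Y ⟶ X), F.map a ≫ x = y ∧
      (∀ i (φ : G i ⟶ X), F.map φ ≫ x = 0 → φ = 0) ∧
      (∀ i (ψ : F.obj (G i) ⟶ c), ∃ φ : G i ⟶ X, F.map φ ≫ x = ψ) ∧
      ∀ P : ObjectProperty D, IsLocalizingClass P → (∀ i, P (G i)) → P Y → P X := by
  let K : (Σ i, (F.obj (G i) ⟶ c)) → D := fun k => G k.1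
  obtain ⟨W, l, r, hWP, hW⟩ := exists_wedge (C := C) Y K
  obtain ⟨x₀, hx₀l, hx₀r⟩ := hW F hF c y (fun k => k.2)
  let Over := Σ X : D, (F.obj X ⟶ c)
  choose X' x' a ha hker hP using fun p : Over => exists_kill F hF c G p.1 p.2
  let t : ℕ → Over := fun n => Nat.rec ⟨W, x₀⟩ (fun _ p => ⟨X' p, x' p⟩) n
  obtain ⟨H, i, hi, hHP, hcomp, hdesc⟩ := exists_hocolim (C := C) (fun n => (t n).1)
    (fun n => a (t n))
  obtain ⟨z, hz⟩ := hdesc F hF c (fun n => (t n).2) (fun n => ha (t n))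
  refine ⟨H, z, l ≫ i 0, ?_, ?_, ?_, ?_⟩
  · rw [F.map_comp, Category.assoc, hz]
    exact hx₀l
  · intro k φ hφ
    obtain ⟨n, ψ, rfl⟩ := hcomp (G k) (hG k) φ
    rw [F.map_comp, Category.assoc, hz] at hφ
    rw [← hi n, ← Category.assoc, hker (t n) k ψ hφ, zero_comp]
  · intro k ψ
    refine ⟨r ⟨k, ψ⟩ ≫ i 0, ?_⟩
    rw [F.map_comp, Category.assoc, hz]
    exact hx₀r ⟨k, ψ⟩
  · intro P hPloc hPG hPY
    refine hHP P hPloc fun n => ?_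
    induction n with
    | zero => exact hWP P hPloc hPY fun k => hPG k.1
    | succ n ih => exact hP (t n) P hPloc hPG ih

variable {G} (hG : IsCompactGeneratingFamily G)

include hF hG

/-- The functor `Hom(F(-), c)` is representable. -/
theorem exists_universal_over :
    ∃ (X : D) (x : F.obj X ⟶ c), ∀ (Y : D) (y : F.obj Y ⟶ c), ∃! a : Y ⟶ X, F.map a ≫ x = y := by
  obtain ⟨X, x, -, -, inj, surj, -⟩ := exists_over_bijective F hF c G hG.compact (0 : D) 0
  -- Every map from `(X, x)` over `c` has a retraction over `c`: enlarge the target until it has the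
  -- same maps from generators as `X`; the composite is then an isomorphism.
  have key : ∀ (Y : D) (y : F.obj Y ⟶ c) (b : X ⟶ Y), F.map b ≫ y = x →
      ∃ r : Y ⟶ X, F.map r ≫ x = y ∧ b ≫ r = 𝟙 X := by
    intro Y y b hb
    obtain ⟨X', x', a, ha, inj', surj', -⟩ := exists_over_bijective F hF c G hG.compact Y y
    have hab : F.map (b ≫ a) ≫ x' = x := by rw [F.map_comp, Category.assoc, ha, hb]
    have : IsIso (b ≫ a) := by
      refine hG.isIso _ (fun i φ hφ => inj i φ ?_) (fun i ψ => ?_)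
      · rw [← hab, ← Category.assoc, ← F.map_comp, hφ, F.map_zero, zero_comp]
      · obtain ⟨φ, hφ⟩ := surj i (F.map ψ ≫ x')
        refine ⟨φ, ?_⟩
        rw [← sub_eq_zero]
        apply inj' i
        rw [F.map_sub, Preadditive.sub_comp, F.map_comp, Category.assoc, hab, hφ, sub_self]
    refine ⟨a ≫ inv (b ≫ a), ?_, ?_⟩
    · rw [F.map_comp, F.map_inv, Category.assoc, ← ha]
      congr 1
      rw [IsIso.inv_comp_eq, hab]
    · rw [← Category.assoc, IsIso.hom_inv_id]
  refine ⟨X, x, fun Y y => ?_⟩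
  -- Apply `key` to the inclusion of `X` into the coproduct of `Y` and `X`, and restrict the
  -- retraction to `Y`.
  have hex : ∃ a : Y ⟶ X, F.map a ≫ x = y := by
    obtain ⟨W, l, r, -, hW⟩ := exists_wedge (C := C) Y (fun _ : PUnit.{v + 1} => X)
    obtain ⟨z, hzl, hzr⟩ := hW F hF c y (fun _ => x)
    obtain ⟨q, hq, -⟩ := key W z (r ⟨⟩) (hzr ⟨⟩)
    exact ⟨l ≫ q, by rw [F.map_comp, Category.assoc, hq, hzl]⟩
  obtain ⟨a, ha⟩ := hex
  refine ⟨a, ha, fun a' ha' => ?_⟩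
  -- The map `x` extends over the cone of `a' - a`, so `X ⟶ Z` is split mono; since it kills `a' -
  -- a`, this difference is zero.
  obtain ⟨Z, b, d, hT⟩ := distinguished_cocone_triangle (a' - a)
  obtain ⟨z, hz⟩ := exists_extension_of_distTriang F hT x (by
    rw [F.map_sub, Preadditive.sub_comp, ha, ha', sub_self])
  obtain ⟨r, -, hr⟩ := key Z z b hz
  have h := distTriang_mk_comp₁₂ hT
  rw [← sub_eq_zero, ← Category.comp_id (a' - a), ← hr, ← Category.assoc, h, zero_comp]

omit c in
/-- **Brown representability**: an exact functor preserving coproducts has a right adjoint. -/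
theorem isLeftAdjoint_of_preservesSmallCoproducts : F.IsLeftAdjoint := by
  have (c : C) : HasTerminal (CostructuredArrow F c) := by
    obtain ⟨X, x, h⟩ := exists_universal_over F hF c hG
    refine IsTerminal.hasTerminal (X := CostructuredArrow.mk x) (IsTerminal.ofUniqueHom
      (fun A => CostructuredArrow.homMk (h _ A.hom).choose (h _ A.hom).choose_spec.1) ?_)
    intro A m
    refine CostructuredArrow.hom_ext _ _ ((h _ A.hom).choose_spec.2 _ ?_)
    exact CostructuredArrow.w m
  exact isLeftAdjoint_of_costructuredArrowTerminals F

end Representability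

/-- A localizing class which contains a compact generating family contains all objects. -/
theorem IsLocalizingClass.all {ι : Type v} {G : ι → D} (hG : IsCompactGeneratingFamily G)
    {P : ObjectProperty D} (hP : IsLocalizingClass P) [P.IsClosedUnderIsomorphisms]
    (h : ∀ i, P (G i)) (y : D) : P y := by
  -- For the identity functor and `c = y`, started at the empty coproduct, the construction gives an
  -- object built from the generators and isomorphic to `y`.
  have hid : PreservesSmallCoproducts (𝟭 D) := fun J => inferInstance
  let K : PEmpty.{v + 1} → D := fun _ => y
  obtain ⟨X, x, -, -, inj, surj, hX⟩ := exists_over_bijective (𝟭 D) hid y G hG.compact (∐ K) 0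
  have : IsIso x := hG.isIso x inj surj
  exact P.prop_of_iso (asIso x) (hX P hP h (hP.sigma K fun j => j.elim))

end Brown

end TTDuality

namespace TTDuality

/-! ### Natural transformations between exact functors preserving coproducts -/

section NatTrans

variable {D : Type u₁} [Category.{v} D] [Preadditive D] [HasZeroObject D] [HasShift D ℤ]
  [∀ n : ℤ, (shiftFunctor D n).Additive] [Pretriangulated D]
  {C : Type u₂} [Category.{v} C] [Preadditive C] [HasZeroObject C] [HasShift C ℤ]
  [∀ n : ℤ, (shiftFunctor C n).Additive] [Pretriangulated C]

/-- The image of a distinguished triangle is exact in the middle. -/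
theorem exists_lift_of_distTriang (F : D ⥤ C) [F.CommShift ℤ] [F.IsTriangulated]
    {T : Triangle D} (hT : T ∈ distTriang D) {t : C} (u : t ⟶ F.obj T.obj₂)
    (hu : u ≫ F.map T.mor₂ = 0) : ∃ w : t ⟶ F.obj T.obj₁, w ≫ F.map T.mor₁ = u := by
  obtain ⟨w, h⟩ := Triangle.coyoneda_exact₂ _ (F.map_distinguished T hT) u hu
  exact ⟨w, h.symm⟩

variable (F G : D ⥤ C) [F.CommShift ℤ] [F.IsTriangulated] [G.CommShift ℤ] [G.IsTriangulated]

/-- A four lemma for natural transformations (not necessarily compatible with the shifts). -/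
theorem isIso_app_obj₃ (θ : F ⟶ G) (T : Triangle D) (hT : T ∈ distTriang D)
    (h₁ : IsIso (θ.app T.obj₁)) (h₂ : IsIso (θ.app T.obj₂))
    (h₁' : IsIso (θ.app (T.obj₁⟦(1 : ℤ)⟧))) (h₂' : IsIso (θ.app (T.obj₂⟦(1 : ℤ)⟧))) :
    IsIso (θ.app T.obj₃) := by
  have hT' := rot_of_distTriang _ hT
  have hT'' := rot_of_distTriang _ hT'
  have z₁₂ : T.mor₁ ≫ T.mor₂ = 0 := comp_distTriang_mor_zero₁₂ _ hT
  have z₂₃ : T.mor₂ ≫ T.mor₃ = 0 := comp_distTriang_mor_zero₂₃ _ hT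
  have z₃₁ : T.mor₃ ≫ T.mor₁⟦(1 : ℤ)⟧' = 0 := comp_distTriang_mor_zero₃₁ _ hT
  have exF₂ : ∀ {t : C} (u : t ⟶ F.obj T.obj₂), u ≫ F.map T.mor₂ = 0 →
      ∃ w, w ≫ F.map T.mor₁ = u := fun u hu => exists_lift_of_distTriang F hT u hu
  have exG₂ : ∀ {t : C} (u : t ⟶ G.obj T.obj₂), u ≫ G.map T.mor₂ = 0 →
      ∃ w, w ≫ G.map T.mor₁ = u := fun u hu => exists_lift_of_distTriang G hT u hu
  have exF₃ : ∀ {t : C} (u : t ⟶ F.obj T.obj₃), u ≫ F.map T.mor₃ = 0 →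
      ∃ w, w ≫ F.map T.mor₂ = u := fun u hu => exists_lift_of_distTriang F hT' u hu
  have exG₃ : ∀ {t : C} (u : t ⟶ G.obj T.obj₃), u ≫ G.map T.mor₃ = 0 →
      ∃ w, w ≫ G.map T.mor₂ = u := fun u hu => exists_lift_of_distTriang G hT' u hu
  have exF₁ : ∀ {t : C} (u : t ⟶ F.obj (T.obj₁⟦(1 : ℤ)⟧)), u ≫ F.map (T.mor₁⟦(1 : ℤ)⟧') = 0 →
      ∃ w, w ≫ F.map T.mor₃ = u := fun u hu => exists_lift_of_distTriang F hT'' u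
        (show u ≫ F.map (-(T.mor₁⟦(1 : ℤ)⟧')) = 0 by
          rw [F.map_neg, Preadditive.comp_neg, hu, neg_zero])
  refine isIso_of_yoneda_bijective _ fun t => ⟨?_, ?_⟩
  · rw [← show ⇑(Preadditive.rightComp t (θ.app T.obj₃)) = fun u => u ≫ θ.app T.obj₃ from rfl,
      injective_iff_map_eq_zero]
    intro u hu
    change u ≫ θ.app _ = 0 at hu
    obtain ⟨w, rfl⟩ := exF₃ u (by
      rw [← cancel_mono (θ.app (T.obj₁⟦(1 : ℤ)⟧)), Category.assoc, θ.naturality,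
        ← Category.assoc, hu, zero_comp, zero_comp])
    obtain ⟨q, hq⟩ := exG₂ (w ≫ θ.app _) (by
      rw [Category.assoc, ← θ.naturality, ← Category.assoc, hu])
    have : w = (q ≫ inv (θ.app _)) ≫ F.map T.mor₁ := by
      rw [← cancel_mono (θ.app T.obj₂), Category.assoc, θ.naturality, Category.assoc,
        IsIso.inv_hom_id_assoc, hq]
    rw [this, Category.assoc, ← F.map_comp, z₁₂, F.map_zero, comp_zero]
  · intro u
    obtain ⟨p, hp⟩ := exF₁ ((u ≫ G.map T.mor₃) ≫ inv (θ.app _)) (by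
      rw [← cancel_mono (θ.app (T.obj₂⟦(1 : ℤ)⟧)), Category.assoc, θ.naturality, Category.assoc,
        IsIso.inv_hom_id_assoc, Category.assoc, ← G.map_comp, z₃₁, G.map_zero, comp_zero,
        zero_comp])
    obtain ⟨q, hq⟩ := exG₃ (u - p ≫ θ.app _) (by
      rw [Preadditive.sub_comp, Category.assoc, ← θ.naturality, ← Category.assoc, hp,
        Category.assoc, IsIso.inv_hom_id, Category.comp_id, sub_self])
    refine ⟨p + (q ≫ inv (θ.app _)) ≫ F.map T.mor₂, ?_⟩
    dsimp only
    rw [Preadditive.add_comp, Category.assoc _ (F.map T.mor₂), θ.naturality, Category.assoc,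
      IsIso.inv_hom_id_assoc, hq, add_sub_cancel]

variable {F G} in
/-- A natural transformation between exact functors preserving coproducts is an isomorphism
if it is so on the compact objects. -/
theorem isIso_app_of_compact [HasCoproducts.{v} D] {ι : Type v} {K : ι → D}
    (hK : IsCompactGeneratingFamily K) (hF : PreservesSmallCoproducts F)
    (hG : PreservesSmallCoproducts G) (θ : F ⟶ G)
    (h : ∀ x, IsCompactObject x → IsIso (θ.app x)) (y : D) : IsIso (θ.app y) := by
  -- All shifts are included because `θ` is not assumed to commute with them.
  let P : ObjectProperty D := fun y => ∀ n : ℤ, IsIso (θ.app (y⟦n⟧))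
  have : P.IsClosedUnderIsomorphisms := ⟨fun {X Y} e hX n => by
    have := hX n
    exact (NatTrans.isIso_app_iff_of_iso θ ((shiftFunctor D n).mapIso e)).1 this⟩
  have hP : IsLocalizingClass P :=
    { sigma := fun {J} X _ hX n => by
        have hs : PreservesSmallCoproducts (shiftFunctor D n) :=
          PreservesSmallCoproducts.of_isLeftAdjoint _
        exact isIso_app_sigma (hs.comp hF) (hs.comp hG) (Functor.whiskerLeft (shiftFunctor D n) θ)
          X fun j => hX j n
      cone := fun T hT h₁ h₂ n => by
        have shift_iso : ∀ {X : D}, P X → IsIso (θ.app ((X⟦n⟧)⟦(1 : ℤ)⟧)) := fun {X} hX =>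
          (NatTrans.isIso_app_iff_of_iso θ ((shiftFunctorAdd D n (1 : ℤ)).app X)).1 (hX (n + 1))
        exact isIso_app_obj₃ F G θ _ (Triangle.shift_distinguished T hT n) (h₁ n) (h₂ n)
          (shift_iso h₁) (shift_iso h₂) }
  have hy : P y := hP.all hK (fun i n => h _ ((hK.compact i).shift n)) y
  exact (NatTrans.isIso_app_iff_of_iso θ ((shiftFunctorZero D ℤ).app y)).1 (hy 0)

end NatTrans

/-! ### Rigidly-compactly generated categories and adjoints -/

section Generators

variable {D : Type u₁} [Category.{v} D] [Preadditive D] [HasZeroObject D] [HasShift D ℤ]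
  [∀ n : ℤ, (shiftFunctor D n).Additive] [Pretriangulated D]

theorem IsRigidlyCompactlyGenerated.exists_generatingFamily [MonoidalCategory D]
    [MonoidalClosed D] (hD : IsRigidlyCompactlyGenerated D) :
    ∃ (ι : Type v) (G : ι → D), IsCompactGeneratingFamily G := by
  obtain ⟨ι, G, hG, h⟩ := hD.exists_generators
  refine ⟨ULift.{v} ℤ × ι, fun p => (G p.2)⟦p.1.down⟧, fun p => (hG p.2).shift _, ?_, ?_⟩
  · rintro ⟨⟨n⟩, i⟩
    exact ⟨⟨⟨n + -1⟩, i⟩, ⟨(shiftFunctorAdd D n (-1 : ℤ)).app _⟩⟩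
  · intro t ht
    refine h t fun i φ => ?_
    have := ht ⟨⟨0⟩, i⟩ (((shiftFunctorZero D ℤ).app (G i)).hom ≫ φ)
    rwa [← cancel_epi ((shiftFunctorZero D ℤ).app (G i)).hom, comp_zero]

theorem IsRigidlyCompactlyGenerated.isIso_of_bijective [MonoidalCategory D]
    [MonoidalClosed D] (hD : IsRigidlyCompactlyGenerated D) {X Y : D} (a : X ⟶ Y)
    (h : ∀ t, IsCompactObject t → Function.Bijective (fun u : t ⟶ X => u ≫ a)) : IsIso a := by
  obtain ⟨ι, G, hG⟩ := hD.exists_generatingFamily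
  exact hG.isIso a (fun i φ hφ => (h _ (hG.compact i)).1 (by simpa using hφ))
    (fun i ψ => (h _ (hG.compact i)).2 ψ)

variable {C : Type u₂} [Category.{v} C] [Preadditive C]

/-- If a left adjoint preserves compact objects, its right adjoint preserves coproducts. -/
theorem preservesSmallCoproducts_rightAdjoint {ι : Type v} {G : ι → D}
    (hG : IsCompactGeneratingFamily G) (hD : HasCoproducts.{v} D) (hC : HasCoproducts.{v} C)
    {f : D ⥤ C} {g : C ⥤ D} (adj : f ⊣ g) [g.Additive] (hf : PreservesCompactObjects f) :
    PreservesSmallCoproducts g := fun J => by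
  have (X : J → C) : IsIso (sigmaComparison g X) := by
    have hι (j : J) : Sigma.ι (fun j => g.obj (X j)) j ≫ sigmaComparison g X =
      g.map (Sigma.ι X j) := ι_comp_sigmaComparison g X j
    have := adj.left_adjoint_additive
    -- Injectivity is checked on components; surjectivity holds since `f (G i)` is compact, so its
    -- maps to `∐ X` are sums of maps through summands.
    refine hG.isIso _ (fun i φ hφ => ?_) (fun i ψ => ?_)
    · refine (hG.compact i).eq_zero_of_sigmaProj φ fun j => ?_
      have h : sigmaComparison g X ≫ g.map (sigmaProj X j) =
          sigmaProj (fun j => g.obj (X j)) j := by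
        refine Sigma.hom_ext _ _ fun k => ?_
        rw [← Category.assoc, hι, ← g.map_comp]
        by_cases hk : k = j
        · subst hk
          rw [ι_sigmaProj_self, ι_sigmaProj_self, g.map_id]
        · rw [ι_sigmaProj_of_ne _ hk, ι_sigmaProj_of_ne _ hk, g.map_zero]
      rw [← h, ← Category.assoc, hφ, zero_comp]
    · obtain ⟨ψ, rfl⟩ := (adj.homEquiv _ _).surjective ψ
      refine (hf _ (hG.compact i)).hom_induction
        (motive := fun ψ => ∃ φ, φ ≫ sigmaComparison g X = adj.homEquiv _ _ ψ) ?_ ?_ ?_ ψ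
      · intro j ψ
        exact ⟨adj.homEquiv _ _ ψ ≫ Sigma.ι (fun j => g.obj (X j)) j, by
          rw [Category.assoc, hι, adj.homEquiv_naturality_right]⟩
      · exact ⟨0, by rw [zero_comp]; exact ((adj.homAddEquiv _ _).map_zero).symm⟩
      · rintro a b ⟨a', ha⟩ ⟨b', hb⟩
        exact ⟨a' + b', by
          rw [Preadditive.add_comp, ha, hb]; exact ((adj.homAddEquiv _ _).map_add a b).symm⟩
  have (X : J → C) : PreservesColimit (Discrete.functor X) g :=
    PreservesCoproduct.of_iso_comparison g X
  exact preservesColimitsOfShape_of_discrete g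

end Generators

end TTDuality

namespace TTDuality

/-! ### Rigid objects and exact pairings -/

section Rigid

open MonoidalClosed

variable {C : Type u₁} [Category.{v} C] [MonoidalCategory C]

/-- For `d = hom(x, 𝟙)`, maps into `d` are equal once they agree after evaluation, so one triangle
identity yields the other. -/
theorem zigzag_comp_eval {x d : C} {ev : x ⊗ d ⟶ 𝟙_ C} {coev : 𝟙_ C ⟶ d ⊗ x}
    (h : x ◁ coev ≫ (α_ x d x).inv ≫ ev ▷ x ≫ (λ_ x).hom = (ρ_ x).hom) :
    x ◁ ((coev ▷ d ≫ (α_ d x d).hom ≫ d ◁ ev) ≫ (ρ_ d).hom) ≫ ev =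
      x ◁ (((λ_ d).hom ≫ (ρ_ d).inv) ≫ (ρ_ d).hom) ≫ ev :=
  calc
    _ = x ◁ coev ▷ d ⊗≫ ((x ⊗ d) ◁ ev ≫ ev ▷ 𝟙_ C) ⊗≫ 𝟙 _ := by monoidal
    _ = 𝟙 _ ⊗≫ (x ◁ coev ≫ (α_ x d x).inv ≫ ev ▷ x ≫ (λ_ x).hom) ▷ d ⊗≫ ev := by
      rw [whisker_exchange]
      monoidal
    _ = _ := by
      rw [h]
      monoidal

section Closed

variable [MonoidalClosed C]

/-- The canonical map `d ⊗ z ⟶ hom(x, z)` for a left dual `d` of `x`. -/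
noncomputable def dualTensorToIhom (d x z : C) [ExactPairing d x] : d ⊗ z ⟶ (ihom x).obj z :=
  curry ((α_ x d z).inv ≫ ε_ d x ▷ z ≫ (λ_ z).hom)

/-- On maps from `t` this is `Hom(t, d ⊗ z) = Hom(x ⊗ t, z)` followed by currying. -/
instance isIso_dualTensorToIhom (d x z : C) [ExactPairing d x] :
    IsIso (dualTensorToIhom d x z) := by
  refine isIso_of_yoneda_bijective _ fun t => ?_
  have h : (fun u : t ⟶ d ⊗ z => u ≫ dualTensorToIhom d x z) =
      curry ∘ (tensorLeftHomEquiv t d x z).symm := by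
    funext u
    apply uncurry_injective
    rw [Function.comp_apply, uncurry_curry, uncurry_natural_left, dualTensorToIhom, uncurry_curry]
    rfl
  rw [h]
  exact ((ihom.adjunction x).homEquiv t z).bijective.comp (Equiv.bijective _)

theorem isRigidObject_of_exactPairing (d x : C) [ExactPairing d x] : IsRigidObject x := by
  intro y
  let a : d ⟶ (ihom x).obj (𝟙_ C) := (ρ_ d).inv ≫ dualTensorToIhom d x (𝟙_ C)
  have ha : x ◁ a ≫ (ihom.ev x).app (𝟙_ C) = ε_ d x := by
    rw [← uncurry_eq, uncurry_natural_left, dualTensorToIhom, uncurry_curry]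
    monoidal
  have h : a ▷ y ≫ rigidComparison x y = dualTensorToIhom d x y := by
    apply uncurry_injective
    rw [uncurry_natural_left, rigidComparison, dualTensorToIhom, uncurry_curry, uncurry_curry,
      ← ha]
    monoidal
  exact IsIso.of_isIso_fac_left h

/-- A rigid object `x` is dual to `hom(x, 𝟙)`. -/
@[reducible]
noncomputable def IsRigidObject.exactPairing {x : C} (hx : IsRigidObject x) :
    ExactPairing ((ihom x).obj (𝟙_ C)) x := by
  have := hx x
  -- The coevaluation corresponds to the identity of `x` under `hom(x, 𝟙) ⊗ x ≅ hom(x, x)`.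
  let coev : 𝟙_ C ⟶ (ihom x).obj (𝟙_ C) ⊗ x := curry (ρ_ x).hom ≫ inv (rigidComparison x x)
  have h : x ◁ coev ≫ (α_ x ((ihom x).obj (𝟙_ C)) x).inv ≫ (ihom.ev x).app (𝟙_ C) ▷ x ≫
      (λ_ x).hom = (ρ_ x).hom := by
    have : uncurry (coev ≫ rigidComparison x x) = (ρ_ x).hom := by
      simp [coev]
    rwa [uncurry_natural_left, rigidComparison, uncurry_curry] at this
  exact
    { coevaluation' := coev
      evaluation' := (ihom.ev x).app (𝟙_ C)
      coevaluation_evaluation' := by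
        rw [← h]
        simp
      evaluation_coevaluation' := by
        rw [← cancel_mono (ρ_ _).hom]
        apply uncurry_injective
        rw [uncurry_eq, uncurry_eq]
        exact zigzag_comp_eval h }

end Closed

section Monoidal

variable {D : Type u₂} [Category.{v} D] [MonoidalCategory D]

open Functor.LaxMonoidal Functor.OplaxMonoidal Functor.Monoidal

/-- The image of an exact pairing under a strong monoidal functor. -/
@[reducible]
def exactPairingMap (F : D ⥤ C) [F.Monoidal] (X Y : D) [ExactPairing X Y] :
    ExactPairing (F.obj X) (F.obj Y) where
  coevaluation' := ε F ≫ F.map (η_ X Y) ≫ δ F X Y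
  evaluation' := μ F Y X ≫ F.map (ε_ X Y) ≫ η F
  coevaluation_evaluation' := by
    have h : F.obj Y ◁ δ F X Y ≫ (α_ _ _ _).inv ≫ μ F Y X ▷ F.obj Y =
        μ F Y (X ⊗ Y) ≫ F.map (α_ _ _ _).inv ≫ δ F (Y ⊗ X) Y := by
      rw [← cancel_mono (μ F (Y ⊗ X) Y)]
      simp only [Category.assoc, δ_μ, Category.comp_id]
      rw [← Functor.LaxMonoidal.associativity_inv, ← whiskerLeft_comp_assoc, δ_μ, whiskerLeft_id, Category.id_comp]
    have h' := congrArg F.map (ExactPairing.coevaluation_evaluation X Y)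
    simp only [F.map_comp] at h'
    simp only [whiskerLeft_comp, comp_whiskerRight, Category.assoc]
    rw [reassoc_of% h, μ_natural_right_assoc, δ_natural_left_assoc, reassoc_of% h']
    rw [Functor.LaxMonoidal.right_unitality, Functor.OplaxMonoidal.left_unitality]
    simp only [Category.assoc]
  evaluation_coevaluation' := by
    have h : δ F X Y ▷ F.obj X ≫ (α_ _ _ _).hom ≫ F.obj X ◁ μ F Y X =
        μ F (X ⊗ Y) X ≫ F.map (α_ _ _ _).hom ≫ δ F X (Y ⊗ X) := by
      rw [← cancel_mono (μ F X (Y ⊗ X))]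
      simp only [Category.assoc, δ_μ, Category.comp_id]
      rw [← Functor.LaxMonoidal.associativity, ← comp_whiskerRight_assoc, δ_μ, id_whiskerRight, Category.id_comp]
    have h' := congrArg F.map (ExactPairing.evaluation_coevaluation X Y)
    simp only [F.map_comp] at h'
    simp only [whiskerLeft_comp, comp_whiskerRight, Category.assoc]
    rw [reassoc_of% h, μ_natural_left_assoc, δ_natural_right_assoc, reassoc_of% h']
    rw [Functor.LaxMonoidal.left_unitality, Functor.OplaxMonoidal.right_unitality]
    simp only [Category.assoc]

end Monoidal

end Rigid

end TTDuality

namespace TTDuality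

/-! ### The projection formula -/

section Projection

open MonoidalClosed
open Functor.LaxMonoidal Functor.OplaxMonoidal Functor.Monoidal

theorem comp_tensorRightHomEquiv {C : Type u₁} [Category.{v} C] [MonoidalCategory C]
    {X X' Y Y' Z : C} [ExactPairing Y Y'] (k : X ⟶ X') (g : X' ⊗ Y ⟶ Z) :
    k ≫ tensorRightHomEquiv X' Y Y' Z g = tensorRightHomEquiv X Y Y' Z (k ▷ Y ≫ g) := by
  apply (tensorRightHomEquiv X Y Y' Z).symm.injective
  rw [tensorRightHomEquiv_symm_naturality, Equiv.symm_apply_apply, Equiv.symm_apply_apply]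

theorem whiskerRight_eq_of_section {C : Type u₁} [Category.{v} C] [MonoidalCategory C]
    {A A' B B' : C} (a : A ⟶ A') {b : B ⟶ B'} {c : B' ⟶ B} (h : b ≫ c = 𝟙 B) :
    a ▷ B = A ◁ b ≫ (a ⊗ₘ c) := by
  rw [tensorHom_def', ← whiskerLeft_comp_assoc, h, whiskerLeft_id, Category.id_comp]

variable {C : Type u₁} [Category.{v} C] [MonoidalCategory C]
  {D : Type u₂} [Category.{v} D] [MonoidalCategory D]
  {f : D ⥤ C} [f.Monoidal] {g : C ⥤ D} (adj : f ⊣ g)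

/-- Strong monoidal functors are compatible with the adjunctions given by exact pairings. -/
theorem map_tensorRightHomEquiv {y' y t z : D} [ExactPairing y' y] (ψ : t ⊗ y' ⟶ z) :
    letI := exactPairingMap f y' y
    f.map (tensorRightHomEquiv t y' y z ψ) ≫ δ f z y =
      tensorRightHomEquiv (f.obj t) (f.obj y') (f.obj y) (f.obj z) (μ f t y' ≫ f.map ψ) := by
  let := exactPairingMap f y' y
  change f.map ((ρ_ t).inv ≫ t ◁ η_ y' y ≫ (α_ t y' y).inv ≫ ψ ▷ y) ≫ δ f z y =
    (ρ_ (f.obj t)).inv ≫ f.obj t ◁ (ε f ≫ f.map (η_ y' y) ≫ δ f y' y) ≫ (α_ _ _ _).inv ≫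
      (μ f t y' ≫ f.map ψ) ▷ f.obj y
  have h : f.obj t ◁ δ f y' y ≫ (α_ _ _ _).inv ≫ μ f t y' ▷ f.obj y =
      μ f t (y' ⊗ y) ≫ f.map (α_ _ _ _).inv ≫ δ f (t ⊗ y') y := by
    rw [← cancel_mono (μ f (t ⊗ y') y)]
    simp only [Category.assoc, δ_μ, Category.comp_id]
    rw [← Functor.LaxMonoidal.associativity_inv, ← whiskerLeft_comp_assoc, δ_μ, whiskerLeft_id,
      Category.id_comp]
  simp only [f.map_comp, whiskerLeft_comp, comp_whiskerRight, Category.assoc]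
  rw [reassoc_of% h, μ_natural_right_assoc, ← δ_natural_left,
    Functor.OplaxMonoidal.right_unitality]
  simp only [Category.assoc, ← whiskerLeft_comp_assoc, η_ε]
  simp

/-- The projection map `g x ⊗ y ⟶ g (x ⊗ f y)`. -/
def projection (x : C) (y : D) : g.obj x ⊗ y ⟶ g.obj (x ⊗ f.obj y) :=
  adj.homEquiv _ _ (δ f (g.obj x) y ≫ adj.counit.app x ▷ f.obj y)

theorem homEquiv_symm_comp_projection {t : D} (x : C) (y : D) (u : t ⟶ g.obj x ⊗ y) :
    (adj.homEquiv _ _).symm (u ≫ projection adj x y) =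
      f.map u ≫ δ f (g.obj x) y ≫ adj.counit.app x ▷ f.obj y := by
  rw [Adjunction.homEquiv_naturality_left_symm, projection, Equiv.symm_apply_apply]

theorem map_projection_counit (x : C) (y : D) :
    f.map (projection adj x y) ≫ adj.counit.app _ =
      δ f (g.obj x) y ≫ adj.counit.app x ▷ f.obj y := by
  have e := (adj.homEquiv _ _).symm_apply_apply (δ f (g.obj x) y ≫ adj.counit.app x ▷ f.obj y)
  rwa [Adjunction.homEquiv_counit] at e

theorem projection_naturality_right (x : C) {y y' : D} (k : y ⟶ y') :
    g.obj x ◁ k ≫ projection adj x y' = projection adj x y ≫ g.map (x ◁ f.map k) := by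
  apply (adj.homEquiv _ _).symm.injective
  rw [homEquiv_symm_comp_projection, Adjunction.homEquiv_naturality_right_symm, projection,
    Equiv.symm_apply_apply, ← δ_natural_right_assoc, Category.assoc, whisker_exchange]
  rfl

/-- Relates the projection map to the lax structure of `g`, in terms of which `dualComparison` is
defined. -/
theorem projection_eq (x : C) (y : D) :
    letI := adj.rightAdjointLaxMonoidal
    projection adj x y = g.obj x ◁ adj.unit.app y ≫ μ g x (f.obj y) := by
  let := adj.rightAdjointLaxMonoidal
  apply (adj.homEquiv _ _).symm.injective
  rw [Adjunction.homEquiv_naturality_left_symm, projection, Equiv.symm_apply_apply,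
    Adjunction.rightAdjointLaxMonoidal_μ]
  refine Eq.trans ?_ (congrArg (f.map (g.obj x ◁ adj.unit.app y) ≫ ·)
    (Equiv.symm_apply_apply _ _).symm)
  refine Eq.trans ?_ (δ_natural_right_assoc f (g.obj x) (adj.unit.app y)
    (adj.counit.app x ⊗ₘ adj.counit.app (f.obj y)))
  exact congrArg (δ f (g.obj x) y ≫ ·)
    (whiskerRight_eq_of_section (adj.counit.app x) (adj.left_triangle_components y))

/-- The projection formula for dualizable `y`. -/
theorem isIso_projection_of_exactPairing (x : C) (y' y : D) [ExactPairing y' y] :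
    IsIso (projection adj x y) := by
  refine isIso_of_yoneda_bijective _ fun t => ?_
  let := exactPairingMap f y' y
  -- Through `Hom(t, g x ⊗ y) = Hom(t ⊗ y', g x) = Hom(f t ⊗ f y', x) = Hom(f t, x ⊗ f y)`.
  have h : (adj.homEquiv _ _).symm ∘ (fun u : t ⟶ g.obj x ⊗ y => u ≫ projection adj x y) =
      tensorRightHomEquiv (f.obj t) (f.obj y') (f.obj y) x ∘ (fun w => μ f t y' ≫ w) ∘
        (adj.homEquiv _ _).symm ∘ (tensorRightHomEquiv t y' y (g.obj x)).symm := by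
    funext u
    obtain ⟨ψ, rfl⟩ := (tensorRightHomEquiv t y' y (g.obj x)).surjective u
    simp only [Function.comp_apply, Equiv.symm_apply_apply]
    rw [homEquiv_symm_comp_projection, ← Category.assoc, map_tensorRightHomEquiv,
      ← tensorRightHomEquiv_naturality, Adjunction.homEquiv_counit, Category.assoc]
    rfl
  rw [← (adj.homEquiv _ _).symm.bijective.of_comp_iff', h]
  exact (Equiv.bijective _).comp (((asIso (μ f t y')).homFromEquiv.symm.bijective).comp
    ((Equiv.bijective _).comp (Equiv.bijective _)))

/-- Compatibility of projection maps with the adjunctions given by exact pairings. -/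
theorem tensorRightHomEquiv_comp_projection {t ω : C} {y' y : D} [ExactPairing y' y] :
    letI := exactPairingMap f y' y
    ∀ (u : t ⊗ f.obj y' ⟶ ω),
    tensorRightHomEquiv (g.obj t) y' y (g.obj ω) (projection adj t y' ≫ g.map u) ≫
      projection adj ω y = g.map (tensorRightHomEquiv t (f.obj y') (f.obj y) ω u) := by
  let := exactPairingMap f y' y
  intro u
  apply (adj.homEquiv _ _).symm.injective
  rw [homEquiv_symm_comp_projection, ← Category.assoc, map_tensorRightHomEquiv,
    ← tensorRightHomEquiv_naturality, Adjunction.homEquiv_counit, adj.counit_naturality,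
    comp_tensorRightHomEquiv, f.map_comp, Category.assoc, Category.assoc]
  refine congrArg (tensorRightHomEquiv (f.obj (g.obj t)) (f.obj y') (f.obj y) ω) ?_
  have hu : f.map (g.map u) ≫ adj.counit.app ω = adj.counit.app _ ≫ u := adj.counit_naturality u
  refine (congrArg (fun w => μ f (g.obj t) y' ≫ f.map (projection adj t y') ≫ w) hu).trans ?_
  have ht := map_projection_counit adj t y'
  rw [reassoc_of% ht, μ_δ_assoc]

section SecondAdjoint

variable {h : D ⥤ C} (adj₂ : g ⊣ h) [∀ x y, IsIso (projection adj x y)]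

/-- The natural map `h 𝟙 ⊗ f y ⟶ h y`. -/
noncomputable def twistComparison (y : D) : h.obj (𝟙_ D) ⊗ f.obj y ⟶ h.obj y :=
  adj₂.homEquiv _ _ (inv (projection adj (h.obj (𝟙_ D)) y) ≫
    adj₂.counit.app (𝟙_ D) ▷ y ≫ (λ_ y).hom)

theorem twistComparison_naturality {y z : D} (k : y ⟶ z) :
    h.obj (𝟙_ D) ◁ f.map k ≫ twistComparison adj adj₂ z =
      twistComparison adj adj₂ y ≫ h.map k := by
  apply (adj₂.homEquiv _ _).symm.injective
  rw [Adjunction.homEquiv_naturality_left_symm, Adjunction.homEquiv_naturality_right_symm,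
    twistComparison, twistComparison, Equiv.symm_apply_apply, Equiv.symm_apply_apply,
    ← cancel_epi (projection adj (h.obj (𝟙_ D)) y), ← Category.assoc,
    ← projection_naturality_right]
  simp [whisker_exchange_assoc]

/-- Yoneda: `Hom(t, h 𝟙 ⊗ f y) = Hom(g (t ⊗ f y'), 𝟙) = Hom(g t ⊗ y', 𝟙) = Hom(g t, y)`. -/
theorem isIso_twistComparison_of_exactPairing (y' y : D) [ExactPairing y' y] :
    IsIso (twistComparison adj adj₂ y) := by
  refine isIso_of_yoneda_bijective _ fun t => ?_
  let := exactPairingMap f y' y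
  have key : (adj₂.homEquiv _ _).symm ∘
      (fun u : t ⟶ h.obj (𝟙_ D) ⊗ f.obj y => u ≫ twistComparison adj adj₂ y) =
      (fun w => w ≫ (λ_ y).hom) ∘ tensorRightHomEquiv (g.obj t) y' y (𝟙_ D) ∘
        (fun w => projection adj t y' ≫ w) ∘ (adj₂.homEquiv _ _).symm ∘
          (tensorRightHomEquiv t (f.obj y') (f.obj y) (h.obj (𝟙_ D))).symm := by
    funext u
    obtain ⟨ψ, rfl⟩ := (tensorRightHomEquiv t (f.obj y') (f.obj y) (h.obj (𝟙_ D))).surjective u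
    simp only [Function.comp_apply, Equiv.symm_apply_apply]
    rw [Adjunction.homEquiv_naturality_left_symm, twistComparison, Equiv.symm_apply_apply,
      ← tensorRightHomEquiv_comp_projection, Category.assoc, IsIso.hom_inv_id_assoc,
      ← Category.assoc, ← tensorRightHomEquiv_naturality, Adjunction.homEquiv_counit,
      Category.assoc]
    rfl
  rw [← (adj₂.homEquiv _ _).symm.bijective.of_comp_iff', key]
  exact ((λ_ y).homToEquiv.bijective).comp ((Equiv.bijective _).comp
    (((asIso (projection adj t y')).homFromEquiv.symm.bijective).comp
      ((Equiv.bijective _).comp (Equiv.bijective _))))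

end SecondAdjoint

end Projection

/-! ### The duality comparison -/

section DualComparison

open MonoidalClosed
open Functor.LaxMonoidal Functor.OplaxMonoidal Functor.Monoidal

variable {C : Type u₁} [Category.{v} C] [MonoidalCategory C] [SymmetricCategory C]
  [MonoidalClosed C] {D : Type u₂} [Category.{v} D] [MonoidalCategory D] [SymmetricCategory D]
  [MonoidalClosed D]

theorem rightAdjoint_μ_braiding {f : D ⥤ C} [f.Braided] {g : C ⥤ D} (adj : f ⊣ g) (x y : C) :
    letI := adj.rightAdjointLaxMonoidal
    μ g x y ≫ g.map (β_ x y).hom = (β_ (g.obj x) (g.obj y)).hom ≫ μ g y x := by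
  let := adj.rightAdjointLaxMonoidal
  apply (adj.homEquiv _ _).symm.injective
  rw [Adjunction.homEquiv_naturality_right_symm, Adjunction.homEquiv_naturality_left_symm,
    Adjunction.rightAdjointLaxMonoidal_μ, Adjunction.rightAdjointLaxMonoidal_μ,
    Equiv.symm_apply_apply, Equiv.symm_apply_apply, Category.assoc,
    BraidedCategory.braiding_naturality, Functor.map_braiding]
  simp

variable {f : D ⥤ C} [f.Monoidal] {g : C ⥤ D} {h : D ⥤ C} (adj₁ : f ⊣ g) (adj₂ : g ⊣ h) (κ : D)

theorem uncurry_dualComparison (x : C) :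
    letI := adj₁.rightAdjointLaxMonoidal
    uncurry (dualComparison adj₁ adj₂ κ x) =
      μ g x ((ihom x).obj (h.obj κ)) ≫ g.map ((ihom.ev x).app (h.obj κ)) ≫ adj₂.counit.app κ := by
  rw [dualComparison, uncurry_curry]

/-- On maps from `t`, up to adjunction bijections, `ζ` is precomposition with the projection map. -/
theorem uncurry_homEquiv_comp_dualComparison (x : C) {t : D}
    (φ : f.obj t ⟶ (ihom x).obj (h.obj κ)) :
    uncurry (adj₁.homEquiv _ _ φ ≫ dualComparison adj₁ adj₂ κ x) =
      projection adj₁ x t ≫ (adj₂.homEquiv _ _).symm (uncurry φ) := by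
  let := adj₁.rightAdjointLaxMonoidal
  rw [uncurry_natural_left, uncurry_dualComparison, projection_eq, Adjunction.homEquiv_counit,
    Adjunction.homEquiv_unit, whiskerLeft_comp, uncurry_eq φ, g.map_comp]
  simp only [Category.assoc]
  rw [μ_natural_right_assoc]

theorem isIso_dualComparison [∀ x y, IsIso (projection adj₁ x y)] (x : C) :
    IsIso (dualComparison adj₁ adj₂ κ x) := by
  refine isIso_of_yoneda_bijective _ fun t => ?_
  have key : uncurry ∘ (fun u => u ≫ dualComparison adj₁ adj₂ κ x) ∘ adj₁.homEquiv t _ =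
      (fun w => projection adj₁ x t ≫ w) ∘ (adj₂.homEquiv _ _).symm ∘ uncurry :=
    funext fun φ => uncurry_homEquiv_comp_dualComparison adj₁ adj₂ κ x φ
  rw [← (adj₁.homEquiv t _).bijective.of_comp_iff,
    ← ((ihom.adjunction (g.obj x)).homEquiv t κ).symm.bijective.of_comp_iff']
  change Function.Bijective (uncurry ∘ _)
  rw [key]
  exact ((asIso (projection adj₁ x t)).homFromEquiv.symm.bijective).comp
    ((Equiv.bijective _).comp ((ihom.adjunction x).homEquiv (f.obj t) (h.obj κ)).symm.bijective)

theorem dualComparison_naturality {x y : C} (k : x ⟶ y) :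
    g.map ((pre k).app (h.obj κ)) ≫ dualComparison adj₁ adj₂ κ x =
      dualComparison adj₁ adj₂ κ y ≫ (pre (g.map k)).app κ := by
  let := adj₁.rightAdjointLaxMonoidal
  apply uncurry_injective
  rw [uncurry_natural_left, uncurry_dualComparison, uncurry_pre_app, uncurry_dualComparison,
    μ_natural_right_assoc, ← g.map_comp_assoc, id_tensor_pre_app_comp_ev, g.map_comp_assoc,
    μ_natural_left_assoc]

/-- Uncurried, the two sides differ only in whether the braiding is applied before or after the lax
structure map of `g`; they agree because `f` is braided. -/
theorem dualComparison_toBidual {f : D ⥤ C} [f.Braided] {g : C ⥤ D} {h : D ⥤ C} (adj₁ : f ⊣ g)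
    (adj₂ : g ⊣ h) (κ : D) (x : C) :
    g.map (toBidual (h.obj κ) x) ≫ dualComparison adj₁ adj₂ κ ((ihom x).obj (h.obj κ)) =
      toBidual κ (g.obj x) ≫ (pre (dualComparison adj₁ adj₂ κ x)).app κ := by
  let := adj₁.rightAdjointLaxMonoidal
  apply uncurry_injective
  rw [uncurry_natural_left, uncurry_dualComparison, uncurry_pre_app, toBidual, toBidual,
    uncurry_curry, BraidedCategory.braiding_naturality_left_assoc, ← uncurry_eq,
    uncurry_dualComparison, μ_natural_right_assoc, ← g.map_comp_assoc,
    whiskerLeft_curry_ihom_ev_app, g.map_comp_assoc, ← Category.assoc,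
    rightAdjoint_μ_braiding, Category.assoc]

end DualComparison

end TTDuality

namespace TTDuality

/-! ### Tensoring the double dual with a dualizable object -/

section Bidual

open MonoidalClosed

variable {C : Type u₁} [Category.{v} C] [MonoidalCategory C] [MonoidalClosed C]

/-- The canonical map `d ⊗ hom(x, κ) ⟶ hom(x ⊗ c, κ)` for a left dual `d` of `c`. -/
noncomputable def dualTensorIhom (d c x κ : C) [ExactPairing d c] :
    d ⊗ (ihom x).obj κ ⟶ (ihom (x ⊗ c)).obj κ :=
  curry ((α_ x c _).hom ≫
    x ◁ ((α_ c d _).inv ≫ ε_ d c ▷ _ ≫ (λ_ _).hom) ≫ (ihom.ev x).app κ)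

instance isIso_dualTensorIhom (d c x κ : C) [ExactPairing d c] :
    IsIso (dualTensorIhom d c x κ) := by
  refine isIso_of_yoneda_bijective _ fun t => ?_
  have h : (fun u : t ⟶ d ⊗ (ihom x).obj κ => u ≫ dualTensorIhom d c x κ) =
      curry ∘ (fun w => (α_ x c t).hom ≫ w) ∘ uncurry ∘
        (tensorLeftHomEquiv t d c ((ihom x).obj κ)).symm := by
    funext u
    apply uncurry_injective
    simp only [Function.comp_apply]
    rw [uncurry_curry, uncurry_natural_left, dualTensorIhom, uncurry_curry, uncurry_eq]
    change _ = (α_ x c t).hom ≫ x ◁ (c ◁ u ≫ (α_ c d _).inv ≫ ε_ d c ▷ _ ≫ (λ_ _).hom) ≫ _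
    simp only [whiskerLeft_comp, Category.assoc, tensor_whiskerLeft, Iso.inv_hom_id_assoc]
  rw [h]
  exact ((ihom.adjunction (x ⊗ c)).homEquiv t κ).bijective.comp
    ((α_ x c t).homFromEquiv.symm.bijective.comp
      (((ihom.adjunction x).homEquiv (c ⊗ t) κ).symm.bijective.comp (Equiv.bijective _)))

variable [SymmetricCategory C]

theorem uncurry_comp_toBidual (κ x : C) {t : C} (ψ : t ⟶ x) :
    uncurry (ψ ≫ toBidual κ x) =
      (β_ ((ihom x).obj κ) t).hom ≫ ψ ▷ _ ≫ (ihom.ev x).app κ := by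
  rw [uncurry_natural_left, toBidual, uncurry_curry,
    BraidedCategory.braiding_naturality_right_assoc]

/-- Duality between `c` and `d` turns composition with `ϖ` of `x ⊗ c` on maps from `t` into
composition with `ϖ` of `x` on maps from `t ⊗ d`, up to isomorphisms. -/
theorem dualTensorIhom_comp_toBidual (d c x κ : C) [ExactPairing d c] {t : C} (ψ : t ⊗ d ⟶ x) :
    dualTensorIhom d c x κ ▷ t ≫
        uncurry (tensorRightHomEquiv t d c x ψ ≫ toBidual κ (x ⊗ c)) =
      ((β_ (d ⊗ (ihom x).obj κ) t).hom ≫ (α_ t d _).inv ≫ (β_ ((ihom x).obj κ) (t ⊗ d)).inv) ≫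
        uncurry (ψ ≫ toBidual κ x) := by
  rw [uncurry_comp_toBidual, uncurry_comp_toBidual,
    BraidedCategory.braiding_naturality_left_assoc, whisker_exchange_assoc, ← uncurry_eq,
    dualTensorIhom, uncurry_curry]
  obtain ⟨φ, rfl⟩ := (tensorRightHomEquiv t d c x).symm.surjective ψ
  rw [Equiv.apply_symm_apply]
  change _ = _ ≫ _ ≫ (φ ▷ d ≫ (α_ x c d).hom ≫ x ◁ ε_ d c ≫ (ρ_ x).hom) ▷ _ ≫ _
  simp only [Category.assoc, Iso.inv_hom_id_assoc]
  monoidal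

theorem bijective_comp_toBidual (d c x κ t : C) [ExactPairing d c]
    (h : Function.Bijective (fun u : t ⟶ x ⊗ c => u ≫ toBidual κ (x ⊗ c))) :
    Function.Bijective (fun u : t ⊗ d ⟶ x => u ≫ toBidual κ x) := by
  let w := (β_ (d ⊗ (ihom x).obj κ) t) ≪≫ (α_ t d _).symm ≪≫ (β_ ((ihom x).obj κ) (t ⊗ d)).symm
  have key : (fun q => w.hom ≫ q) ∘ uncurry ∘ (fun u : t ⊗ d ⟶ x => u ≫ toBidual κ x) =
      (fun q => dualTensorIhom d c x κ ▷ t ≫ q) ∘ uncurry ∘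
        (fun u : t ⟶ x ⊗ c => u ≫ toBidual κ (x ⊗ c)) ∘ tensorRightHomEquiv t d c x :=
    funext fun ψ => (dualTensorIhom_comp_toBidual d c x κ ψ).symm
  rw [← Function.Bijective.of_comp_iff'
      ((ihom.adjunction ((ihom x).obj κ)).homEquiv (t ⊗ d) κ).symm.bijective,
    ← Function.Bijective.of_comp_iff' w.homFromEquiv.symm.bijective]
  change Function.Bijective ((fun q => w.hom ≫ q) ∘ uncurry ∘ _)
  rw [key]
  exact ((asIso (dualTensorIhom d c x κ ▷ t)).homFromEquiv.symm.bijective).comp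
    (((ihom.adjunction ((ihom (x ⊗ c)).obj κ)).homEquiv t κ).symm.bijective.comp
      (h.comp (Equiv.bijective _)))

end Bidual

/-! ### Dualities -/

section Dualities

variable {A : Type u₁} [Category.{v} A] (d : WeakDuality A)

/-- The adjunction between `dual` and its opposite. -/
def WeakDuality.adjunction : d.dual.rightOp ⊣ d.dual :=
  Adjunction.mkOfUnitCounit
    { unit := d.bidual
      counit :=
        { app := fun x => (d.bidual.app x.unop).op
          naturality := fun _ _ f => Quiver.Hom.unop_inj (d.bidual.naturality f.unop).symm }
      left_triangle := by
        ext x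
        exact Quiver.Hom.unop_inj (by simpa using d.bidual_dual x)
      right_triangle := by
        ext x
        simpa using d.bidual_dual x.unop }

/-- The maps `ϖ` are both the unit and, reversed, the counit of the adjunction between `dual` and
its opposite. -/
theorem WeakDuality.isEquivalence_iff :
    d.dual.IsEquivalence ↔ ∀ x, IsIso (d.bidual.app x) := by
  constructor
  · intro _ x
    exact inferInstanceAs (IsIso (d.adjunction.unit.app x))
  · intro h
    have h₁ (x : A) : IsIso (d.adjunction.unit.app x) := h x
    have h₂ (x : Aᵒᵖ) : IsIso (d.adjunction.counit.app x) :=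
      have := h x.unop
      inferInstanceAs (IsIso (d.bidual.app x.unop).op)
    exact d.adjunction.toEquivalence.isEquivalence_inverse

end Dualities

section Dualizing

variable {C : Type u₁} [Category.{v} C] [MonoidalCategory C] [SymmetricCategory C]
  [MonoidalClosed C]

theorem IsDualizing.isIso_toBidual {P : ObjectProperty C} {κ : C} (h : IsDualizing P κ) {x : C}
    (hx : P x) : IsIso (toBidual κ x) := by
  have := (WeakDuality.isEquivalence_iff _).1 h.isEquivalence ⟨x, hx⟩
  exact inferInstanceAs (IsIso (P.ι.map
    (((twistedDuality κ).restrict P h.stable).bidual.app ⟨x, hx⟩)))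

theorem IsDualizing.of_isIso_toBidual {P : ObjectProperty C} {κ : C} (hκ : P κ)
    (stable : ∀ x : C, P x → P ((ihom x).obj κ)) (h : ∀ x, P x → IsIso (toBidual κ x)) :
    IsDualizing P κ where
  mem := hκ
  stable := stable
  isEquivalence := by
    rw [WeakDuality.isEquivalence_iff]
    intro x
    have : IsIso (P.ι.map (((twistedDuality κ).restrict P stable).bidual.app x)) :=
      h x.obj x.property
    exact isIso_of_fully_faithful P.ι _

end Dualizing

end TTDuality

namespace TTDuality

/-! ### Duals and tensor products of compact objects. -/

section RigidlyCompactlyGenerated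

variable {C : Type u₁} [Category.{v} C] [Preadditive C] [MonoidalCategory C] [SymmetricCategory C]
  [MonoidalClosed C] (hC : IsRigidlyCompactlyGenerated C)

include hC

theorem IsRigidlyCompactlyGenerated.isCompactObject_of_exactPairing (d c : C)
    [ExactPairing d c] : IsCompactObject c :=
  (hC.compact_iff_rigid c).2 (isRigidObject_of_exactPairing d c)

theorem IsRigidlyCompactlyGenerated.isCompactObject_unit : IsCompactObject (𝟙_ C) :=
  hC.isCompactObject_of_exactPairing (𝟙_ C) (𝟙_ C)

/-- Compact objects have compact duals. -/
theorem IsRigidlyCompactlyGenerated.exists_dual {c : C} (hc : IsCompactObject c) :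
    ∃ d : C, Nonempty (ExactPairing d c) ∧ Nonempty (ExactPairing c d) ∧ IsCompactObject d := by
  let := ((hC.compact_iff_rigid c).1 hc).exactPairing
  let d := (ihom c).obj (𝟙_ C)
  let := BraidedCategory.exactPairing_swap d c
  exact ⟨d, ⟨inferInstance⟩, ⟨inferInstance⟩, hC.isCompactObject_of_exactPairing c d⟩

theorem IsRigidlyCompactlyGenerated.tensor {c c' : C} (hc : IsCompactObject c)
    (hc' : IsCompactObject c') : IsCompactObject (c ⊗ c') := by
  obtain ⟨d, ⟨_⟩, -⟩ := hC.exists_dual hc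
  obtain ⟨d', ⟨_⟩, -⟩ := hC.exists_dual hc'
  exact hC.isCompactObject_of_exactPairing (d' ⊗ d) (c ⊗ c')

theorem preservesCompactObjects_of_monoidal {D : Type u₂} [Category.{v} D] [Preadditive D]
    [MonoidalCategory D] [SymmetricCategory D] [MonoidalClosed D]
    (hD : IsRigidlyCompactlyGenerated D) (f : D ⥤ C) [f.Monoidal] : PreservesCompactObjects f := by
  intro c hc
  obtain ⟨d, ⟨_⟩, -⟩ := hD.exists_dual hc
  let := exactPairingMap f d c
  exact hC.isCompactObject_of_exactPairing (f.obj d) (f.obj c)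

end RigidlyCompactlyGenerated

/-! ### From compact objects to all objects; the compact pull-back as a submodule. -/

section TensorTriangulated

open ZeroObject

attribute [local instance] TensorTriangulatedCategory.commShift₂
  TensorTriangulatedCategory.tensor_exact

variable {C : Type u₁} [Category.{v} C] [Preadditive C] [HasZeroObject C] [HasShift C ℤ]
  [∀ n : ℤ, (shiftFunctor C n).Additive] [Pretriangulated C]
  [MonoidalCategory C] [SymmetricCategory C] [MonoidalClosed C] [TensorTriangulatedCategory C]
  {D : Type u₂} [Category.{v} D] [Preadditive D] [HasZeroObject D] [HasShift D ℤ]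
  [∀ n : ℤ, (shiftFunctor D n).Additive] [Pretriangulated D]
  [MonoidalCategory D] [SymmetricCategory D] [MonoidalClosed D] [TensorTriangulatedCategory D]

theorem preservesSmallCoproducts_tensor (Y : C) :
    PreservesSmallCoproducts ((curriedTensor C).flip.obj Y) :=
  have : ((curriedTensor C).flip.obj Y).IsLeftAdjoint :=
    Functor.isLeftAdjoint_of_iso (BraidedCategory.tensorLeftIsoTensorRight Y)
  PreservesSmallCoproducts.of_isLeftAdjoint _

/-- The **projection formula**. -/
theorem isIso_projection (hD : IsRigidlyCompactlyGenerated D) {f : D ⥤ C} [f.Braided]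
    [f.CommShift ℤ] [f.IsTriangulated] (hf : PreservesSmallCoproducts f) {g : C ⥤ D} (adj : f ⊣ g)
    [g.CommShift ℤ] [g.IsTriangulated] (hg : PreservesSmallCoproducts g) (x : C) (y : D) :
    IsIso (projection adj x y) := by
  obtain ⟨ι, K, hK⟩ := hD.exists_generatingFamily
  have := hD.hasCoproducts
  -- The braidings move `y` to the left factor, the variable in which the tensor product is given as
  -- exact.
  let θ : (curriedTensor D).flip.obj (g.obj x) ⟶ f ⋙ (curriedTensor C).flip.obj x ⋙ g :=
    { app := fun y => (β_ y (g.obj x)).hom ≫ projection adj x y ≫ g.map (β_ x (f.obj y)).hom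
      naturality := fun y y' k => by
        change k ▷ g.obj x ≫ _ = _ ≫ g.map (f.map k ▷ x)
        rw [BraidedCategory.braiding_naturality_left_assoc,
          reassoc_of% projection_naturality_right adj x k, Category.assoc, Category.assoc,
          ← g.map_comp, ← g.map_comp, BraidedCategory.braiding_naturality_right] }
  have h (y : D) : IsIso (θ.app y) ↔ IsIso (projection adj x y) := by
    change IsIso ((β_ y (g.obj x)).hom ≫ projection adj x y ≫ g.map (β_ x (f.obj y)).hom) ↔ _
    rw [isIso_comp_left_iff, isIso_comp_right_iff]
  rw [← h]
  refine isIso_app_of_compact hK (preservesSmallCoproducts_tensor _)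
    (hf.comp ((preservesSmallCoproducts_tensor x).comp hg)) θ (fun c hc => (h c).2 ?_) y
  obtain ⟨d, ⟨_⟩, -⟩ := hD.exists_dual hc
  exact isIso_projection_of_exactPairing adj x d c

theorem isIso_twistComparison (hD : IsRigidlyCompactlyGenerated D) {f : D ⥤ C} [f.Braided]
    [f.CommShift ℤ] [f.IsTriangulated] (hf : PreservesSmallCoproducts f) {g : C ⥤ D} (adj : f ⊣ g)
    [∀ x y, IsIso (projection adj x y)] {h : D ⥤ C} (adj₂ : g ⊣ h) [h.CommShift ℤ]
    [h.IsTriangulated] (hh : PreservesSmallCoproducts h) (y : D) :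
    IsIso (twistComparison adj adj₂ y) := by
  obtain ⟨ι, K, hK⟩ := hD.exists_generatingFamily
  have := hD.hasCoproducts
  let ω := h.obj (𝟙_ D)
  let θ : f ⋙ (curriedTensor C).flip.obj ω ⟶ h :=
    { app := fun y => (β_ (f.obj y) ω).hom ≫ twistComparison adj adj₂ y
      naturality := fun y y' k => by
        change f.map k ▷ ω ≫ _ = _
        rw [BraidedCategory.braiding_naturality_left_assoc, twistComparison_naturality,
          Category.assoc] }
  have h (y : D) : IsIso (θ.app y) ↔ IsIso (twistComparison adj adj₂ y) := by
    change IsIso ((β_ (f.obj y) ω).hom ≫ twistComparison adj adj₂ y) ↔ _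
    rw [isIso_comp_left_iff]
  rw [← h]
  refine isIso_app_of_compact hK (hf.comp (preservesSmallCoproducts_tensor _)) hh θ
    (fun c hc => (h c).2 ?_) y
  obtain ⟨d, ⟨_⟩, -⟩ := hD.exists_dual hc
  exact isIso_twistComparison_of_exactPairing adj adj₂ d c

/-- The class `compactPullback g D₀` is a submodule. -/
theorem isCompactSubmodule_compactPullback (hC : IsRigidlyCompactlyGenerated C) (g : C ⥤ D)
    [g.CommShift ℤ] [g.IsTriangulated] (D₀ : ObjectProperty D) [IsCompactSubmodule D₀] :
    IsCompactSubmodule (compactPullback g D₀) := by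
  have := IsCompactSubmodule.isStableUnderRetracts (P := D₀)
  -- The pull-back is the intersection, over compact `c`, of preimages of `D₀` under the exact
  -- functors `g (- ⊗ c)`.
  let Q (c : C) : ObjectProperty C := D₀.inverseImage ((curriedTensor C).flip.obj c ⋙ g)
  have hQ (c : C) : (Q c).IsTriangulated := inferInstance
  have hiff (x : C) : compactPullback g D₀ x ↔ ∀ c, IsCompactObject c → Q c x :=
    forall₂_congr fun c _ => D₀.prop_iff_of_iso (g.mapIso (β_ c x))
  have : (compactPullback g D₀).IsClosedUnderIsomorphisms := ⟨fun {X Y} e hX c hc =>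
    D₀.prop_of_iso (g.mapIso (whiskerLeftIso c e)) (hX c hc)⟩
  refine
    { isTriangulated :=
        { exists_zero := ⟨0, isZero_zero C, (hiff _).2 fun c _ => (Q c).prop_zero⟩
          isStableUnderShiftBy := fun n => ⟨fun x hx => (hiff _).2 fun c hc =>
            (Q c).le_shift n _ ((hiff x).1 hx c hc)⟩
          ext₂' := fun T hT h₁ h₃ => ObjectProperty.le_isoClosure _ _ ((hiff _).2 fun c hc =>
            (Q c).ext_of_isTriangulatedClosed₂ T hT ((hiff _).1 h₁ c hc) ((hiff _).1 h₃ c hc)) }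
      isStableUnderRetracts := ⟨fun {X Y} r hY c hc =>
        D₀.prop_of_retract ((r.map ((curriedTensor C).obj c)).map g) (hY c hc)⟩
      tensor_mem := fun c x hc hx c' hc' =>
        D₀.prop_of_iso (g.mapIso (α_ c' c x)) (hx _ (hC.tensor hc' hc)) }

end TensorTriangulated

end TTDuality

namespace TTDuality

/-! ### Duality on the compact pull-back. -/

section Main

variable {C : Type u₁} [Category.{v} C] [Preadditive C] [HasZeroObject C] [HasShift C ℤ]
  [∀ n : ℤ, (shiftFunctor C n).Additive] [Pretriangulated C]
  [MonoidalCategory C] [SymmetricCategory C] [MonoidalClosed C] [TensorTriangulatedCategory C]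
  {D : Type u₂} [Category.{v} D] [Preadditive D] [HasZeroObject D] [HasShift D ℤ]
  [∀ n : ℤ, (shiftFunctor D n).Additive] [Pretriangulated D]
  [MonoidalCategory D] [SymmetricCategory D] [MonoidalClosed D] [TensorTriangulatedCategory D]

/-- A submodule is closed under `hom(c, -)` for compact `c`. -/
theorem IsCompactSubmodule.ihom_mem (hD : IsRigidlyCompactlyGenerated D) {D₀ : ObjectProperty D}
    [IsCompactSubmodule D₀] {c κ : D} (hc : IsCompactObject c) (hκ : D₀ κ) :
    D₀ ((ihom c).obj κ) := by
  have := IsCompactSubmodule.isStableUnderRetracts (P := D₀)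
  obtain ⟨d, ⟨_⟩, -, hd⟩ := hD.exists_dual hc
  exact D₀.prop_of_iso (asIso (dualTensorToIhom d c κ)) (IsCompactSubmodule.tensor_mem d κ hd hκ)

theorem compactPullback_obj (hC : IsRigidlyCompactlyGenerated C) {g : C ⥤ D}
    {D₀ : ObjectProperty D} [IsCompactSubmodule D₀] {x : C} (hx : compactPullback g D₀ x) :
    D₀ (g.obj x) :=
  have := IsCompactSubmodule.isStableUnderRetracts (P := D₀)
  D₀.prop_of_iso (g.mapIso (λ_ x)) (hx _ hC.isCompactObject_unit)

variable {f : D ⥤ C} [f.Braided] {g : C ⥤ D} {h : D ⥤ C} (adj₁ : f ⊣ g) (adj₂ : g ⊣ h)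
  [∀ x y, IsIso (projection adj₁ x y)] (hC : IsRigidlyCompactlyGenerated C)
  (hD : IsRigidlyCompactlyGenerated D) {D₀ : ObjectProperty D}
  [IsCompactSubmodule D₀] {κ : D} (hκ : IsDualizing D₀ κ)

include adj₁ adj₂ hC in
-- For `d` dual to `c`, `g (c ⊗ h κ) ≅ g hom(d, h κ) ≅ hom(g d, κ)`, and `g d` is compact.
theorem compactPullback_mem (hD : IsRigidlyCompactlyGenerated D) (hg : PreservesCompactObjects g)
    (hκ : D₀ κ) : compactPullback g D₀ (h.obj κ) := by
  have := IsCompactSubmodule.isStableUnderRetracts (P := D₀)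
  intro c hc
  obtain ⟨d, -, ⟨_⟩, hd⟩ := hC.exists_dual hc
  have := isIso_dualComparison adj₁ adj₂ κ d
  exact D₀.prop_of_iso (g.mapIso (asIso (dualTensorToIhom c d (h.obj κ))) ≪≫
    asIso (dualComparison adj₁ adj₂ κ d)).symm
      (IsCompactSubmodule.ihom_mem hD (hg d hd) hκ)

include adj₁ adj₂ hC hκ in
theorem compactPullback_ihom_mem {x : C} (hx : compactPullback g D₀ x) :
    compactPullback g D₀ ((ihom x).obj (h.obj κ)) := by
  have := IsCompactSubmodule.isStableUnderRetracts (P := D₀)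
  intro c hc
  obtain ⟨d, -, ⟨_⟩, hd⟩ := hC.exists_dual hc
  have := isIso_dualComparison adj₁ adj₂ κ (x ⊗ d)
  exact D₀.prop_of_iso (g.mapIso (asIso (dualTensorIhom c d x (h.obj κ))) ≪≫
    asIso (dualComparison adj₁ adj₂ κ (x ⊗ d))).symm
      (hκ.stable _ (D₀.prop_of_iso (g.mapIso (β_ d x)) (hx d hd)))

include adj₁ adj₂ hC hκ in
/-- The image under `g` of the map to the double dual is invertible. -/
theorem isIso_map_toBidual {x : C} (hx : compactPullback g D₀ x) :
    IsIso (g.map (toBidual (h.obj κ) x)) := by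
  have := isIso_dualComparison adj₁ adj₂ κ x
  have := isIso_dualComparison adj₁ adj₂ κ ((ihom x).obj (h.obj κ))
  have := hκ.isIso_toBidual (compactPullback_obj hC hx)
  have : IsIso ((MonoidalClosed.pre (dualComparison adj₁ adj₂ κ x)).app κ) :=
    inferInstanceAs (IsIso ((MonoidalClosed.internalHom.map
      (dualComparison adj₁ adj₂ κ x).op).app κ))
  exact IsIso.of_isIso_fac_right (dualComparison_toBidual adj₁ adj₂ κ x)

include adj₁ adj₂ hC hκ in
-- Applying `g` and testing on the unit only sees maps from `f 𝟙 ≅ 𝟙`; tensoring `x` with the dual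
-- of `d` makes these into maps from an arbitrary compact `d`.
theorem isIso_toBidual_of_compactPullback (hP : IsCompactSubmodule (compactPullback g D₀))
    {x : C} (hx : compactPullback g D₀ x) : IsIso (toBidual (h.obj κ) x) := by
  have := hP.isStableUnderRetracts
  refine hC.isIso_of_bijective _ fun d hd => ?_
  obtain ⟨c, -, ⟨_⟩, hc⟩ := hC.exists_dual hd
  have hxc : compactPullback g D₀ (x ⊗ c) :=
    (compactPullback g D₀).prop_of_iso (β_ c x) (hP.tensor_mem c x hc hx)
  have hiso := isIso_map_toBidual adj₁ adj₂ hC hκ hxc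
  have h₁ : Function.Bijective
      (fun u : f.obj (𝟙_ D) ⟶ x ⊗ c => u ≫ toBidual (h.obj κ) (x ⊗ c)) := by
    have e : adj₁.homEquiv _ _ ∘
        (fun u : f.obj (𝟙_ D) ⟶ x ⊗ c => u ≫ toBidual (h.obj κ) (x ⊗ c)) =
        (fun u => u ≫ g.map (toBidual (h.obj κ) (x ⊗ c))) ∘ adj₁.homEquiv _ _ :=
      funext fun u => adj₁.homEquiv_naturality_right u _
    rw [← Function.Bijective.of_comp_iff' (adj₁.homEquiv _ _).bijective, e]
    exact (asIso (g.map (toBidual (h.obj κ) (x ⊗ c)))).homToEquiv.bijective.comp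
      (Equiv.bijective _)
  have h₂ := bijective_comp_toBidual d c x (h.obj κ) (f.obj (𝟙_ D)) h₁
  let e : f.obj (𝟙_ D) ⊗ d ≅ d := whiskerRightIso (Functor.Monoidal.εIso f).symm d ≪≫ λ_ d
  have e' : (fun u : f.obj (𝟙_ D) ⊗ d ⟶ x => u ≫ toBidual (h.obj κ) x) ∘
      (fun u : d ⟶ x => e.hom ≫ u) =
        (fun u => e.hom ≫ u) ∘ (fun u : d ⟶ x => u ≫ toBidual (h.obj κ) x) :=
    funext fun u => Category.assoc _ _ _
  rw [← Function.Bijective.of_comp_iff' e.homFromEquiv.symm.bijective]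
  change Function.Bijective ((fun u => e.hom ≫ u) ∘ _)
  rw [← e']
  exact h₂.comp e.homFromEquiv.symm.bijective

include adj₁ adj₂ hC hD hκ in
/-- The object `h κ` is dualizing for the compact pull-back. -/
theorem isDualizing_compactPullback (hg : PreservesCompactObjects g)
    (hP : IsCompactSubmodule (compactPullback g D₀)) :
    IsDualizing (compactPullback g D₀) (h.obj κ) :=
  IsDualizing.of_isIso_toBidual (compactPullback_mem adj₁ adj₂ hC hD hg hκ.mem)
    (fun _ hx => compactPullback_ihom_mem adj₁ adj₂ hC hκ hx)
    (fun _ hx => isIso_toBidual_of_compactPullback adj₁ adj₂ hC hκ hP hx)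

/-- The restriction of `g` is duality-preserving. -/
noncomputable def dualityPreservingRestrict
    (hκ' : IsDualizing (compactPullback g D₀) (h.obj κ))
    (hg : ∀ x : (compactPullback g D₀).FullSubcategory, D₀ (g.obj x.obj)) :
    DualityPreserving
      ((twistedDuality (h.obj κ)).restrict (compactPullback g D₀) hκ'.stable)
      ((twistedDuality κ).restrict D₀ hκ.stable)
      (D₀.lift ((compactPullback g D₀).ι ⋙ g) hg) where
  ζ := NatIso.ofComponents
    (fun x =>
      D₀.isoMk (@asIso _ _ _ _ (dualComparison adj₁ adj₂ κ x.unop.obj)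
        (isIso_dualComparison adj₁ adj₂ κ x.unop.obj)))
    (fun k => ObjectProperty.hom_ext _
      (dualComparison_naturality adj₁ adj₂ κ k.unop.hom))
  comm x := ObjectProperty.hom_ext _ (dualComparison_toBidual adj₁ adj₂ κ x.obj)

end Main

end TTDuality

theorem mainTheorem4
    {C : Type u₁} [Category.{v} C] [Preadditive C] [HasZeroObject C] [HasShift C ℤ]
    [∀ n : ℤ, (shiftFunctor C n).Additive] [Pretriangulated C] [IsTriangulated C]
    [MonoidalCategory C] [SymmetricCategory C] [MonoidalClosed C]
    [TTDuality.TensorTriangulatedCategory C]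
    {D : Type u₂} [Category.{v} D] [Preadditive D] [HasZeroObject D] [HasShift D ℤ]
    [∀ n : ℤ, (shiftFunctor D n).Additive] [Pretriangulated D] [IsTriangulated D]
    [MonoidalCategory D] [SymmetricCategory D] [MonoidalClosed D]
    [TTDuality.TensorTriangulatedCategory D]
    (hC : TTDuality.IsRigidlyCompactlyGenerated C)
    (hD : TTDuality.IsRigidlyCompactlyGenerated D)
    (f : D ⥤ C) [f.Braided] [f.CommShift ℤ] [f.IsTriangulated]
    (hf : TTDuality.PreservesSmallCoproducts f) :
    -- `f` has a right adjoint `g`, which itself has a right adjoint `h`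
    f.IsLeftAdjoint ∧ ∀ (g : C ⥤ D) (adj₁ : f ⊣ g), g.IsLeftAdjoint ∧
    ∀ (h : D ⥤ C) (adj₂ : g ⊣ h),
    -- Grothendieck-Neeman duality
    TTDuality.PreservesCompactObjects g →
    ∀ (D₀ : ObjectProperty D) [TTDuality.IsCompactSubmodule D₀] (κ : D)
      (hκ : TTDuality.IsDualizing D₀ κ),
      Nonempty (h.obj κ ≅ h.obj (𝟙_ D) ⊗ f.obj κ) ∧
      ∃ (_ : TTDuality.IsCompactSubmodule (TTDuality.compactPullback g D₀))
        (hκ' : TTDuality.IsDualizing (TTDuality.compactPullback g D₀) (h.obj κ))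
        (hg : ∀ x : (TTDuality.compactPullback g D₀).FullSubcategory, D₀ (g.obj x.obj)),
        -- the restriction of `g` is exact
        (letI : g.CommShift ℤ := adj₁.rightAdjointCommShift ℤ
         (D₀.lift ((TTDuality.compactPullback g D₀).ι ⋙ g) hg).IsTriangulated) ∧
        -- the restriction of `g` is duality-preserving, via the canonical comparison maps
        ∃ Φ : TTDuality.DualityPreserving
            ((TTDuality.twistedDuality (h.obj κ)).restrict (TTDuality.compactPullback g D₀)
              hκ'.stable)
            ((TTDuality.twistedDuality κ).restrict D₀ hκ.stable)
            (D₀.lift ((TTDuality.compactPullback g D₀).ι ⋙ g) hg),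
          ∀ x : (TTDuality.compactPullback g D₀).FullSubcategory,
            (Φ.ζ.hom.app (Opposite.op x)).hom =
              TTDuality.dualComparison adj₁ adj₂ κ x.obj := by
  have := hC.hasCoproducts
  have := hD.hasCoproducts
  obtain ⟨ιD, GD, hGD⟩ := hD.exists_generatingFamily
  obtain ⟨ιC, GC, hGC⟩ := hC.exists_generatingFamily
  refine ⟨TTDuality.isLeftAdjoint_of_preservesSmallCoproducts f hf hGD, fun g adj₁ => ?_⟩
  let : g.CommShift ℤ := adj₁.rightAdjointCommShift ℤ
  have : adj₁.CommShift ℤ := adj₁.commShift_of_leftAdjoint ℤ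
  have : g.IsTriangulated := adj₁.isTriangulated_rightAdjoint
  have hg : TTDuality.PreservesSmallCoproducts g :=
    TTDuality.preservesSmallCoproducts_rightAdjoint hGD hD.hasCoproducts hC.hasCoproducts adj₁
      (TTDuality.preservesCompactObjects_of_monoidal hC hD f)
  refine ⟨TTDuality.isLeftAdjoint_of_preservesSmallCoproducts g hg hGC, ?_⟩
  intro h adj₂ hgc D₀ _ κ hκ
  let : h.CommShift ℤ := adj₂.rightAdjointCommShift ℤ
  have : adj₂.CommShift ℤ := adj₂.commShift_of_leftAdjoint ℤ
  have : h.IsTriangulated := adj₂.isTriangulated_rightAdjoint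
  -- Grothendieck–Neeman duality enters here, and again in the membership of `h κ` in the pull-back.
  have hh : TTDuality.PreservesSmallCoproducts h :=
    TTDuality.preservesSmallCoproducts_rightAdjoint hGC hC.hasCoproducts hD.hasCoproducts adj₂ hgc
  have hproj (x : C) (y : D) : IsIso (TTDuality.projection adj₁ x y) :=
    TTDuality.isIso_projection hD hf adj₁ hg x y
  have := TTDuality.isIso_twistComparison hD hf adj₁ adj₂ hh κ
  have hP := TTDuality.isCompactSubmodule_compactPullback hC g D₀
  have hκ' := TTDuality.isDualizing_compactPullback adj₁ adj₂ hC hD hκ hgc hP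
  refine ⟨⟨(asIso (TTDuality.twistComparison adj₁ adj₂ κ)).symm⟩, hP, hκ',
    fun x => TTDuality.compactPullback_obj hC x.property, ?_,
    TTDuality.dualityPreservingRestrict adj₁ adj₂ hκ hκ' _, fun _ => rfl⟩
  infer_instance
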